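/- Let $\mathbb T=\mathbb R/2\pi\mathbb Z$ and let $\Omega=\{(r,\theta,z): r\in[\pi,2\pi],\ \theta\in\mathbb T,\ z\in\mathbb T\}$ be the annular Taylor–Couette tank in cylindrical coordinates, with volume $r\,dr\,d\theta\,dz$. Consider the 3D axisymmetric Euler equation on $\Omega$ for $u^\theta(r,z,t)$ and $\omega^\theta(r,z,t)$: $$D_t(ru^\theta)=0,\qquad D_t\Big(\frac{\omega^\theta}{r}\Big)=\frac{\partial_z\big((ru^\theta)^2\big)}{r^4},\qquad D_t=\partial_t+u^r\partial_r+u^z\partial_z,$$ where $(u^r,u^z)$ is given by the Biot–Savart law $$(u^r,u^z)=\frac1r(-\partial_z\psi,\ \partial_r\psi),\qquad -\frac1r\partial_r\Big(\frac1r\partial_r\psi\Big)-\frac1{r^2}\partial_z^2\psi=\frac{\omega^\theta}{r},$$ with $\psi$ $2\pi$-periodic in $z$ and $\psi=0$ on $r=\pi$ and $r=2\pi$ (so that there is no penetration, $u^r=0$, at these walls). Let $u=u^re_r+u^\theta e_\theta+u^ze_z$. Let $u^\theta_0(r,z)\in C^\infty(\Omega)$ be even in $z$ and let $\omega^\theta_0(r,z)\in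 C^\infty(\Omega)$ be odd in $z$. Assume that there is $k_0>0$ such that $u^\theta_0\ge k_0$ on $z=\pi$ and $|u^\theta_0|\le\frac18k_0$ on $z=0$. Then there exist constants $T_0\ge0$ and $c>0$, depending only on the initial data $(u_0^\theta,\omega_0^\theta)$, such that for every $T\in(0,\infty]$ and every smooth solution on $[0,T)$ with initial data $(u^\theta_0,\omega^\theta_0)$ (in particular when $T$ is the lifespan of the smooth solution), $$\|\omega^\theta(t)\|_{L^p(\Omega)}\ge c\,t^{3-\frac2p}\quad\text{for all }p\in[1,\infty]\text{ and all }t\in[T_0,T),$$ with $\frac2p=0$ for $p=\infty$, and $$\|u(t)\|_{L^\infty(\Omega)}\ge c\,t\quad\text{for all }t\in[T_0,T).$$ Moreover, if $\int_0^\pi\int_\pi^{2\pi}\omega^\theta_0\,dr\,dz\ge0$, then both estimates hold with $T_0=0$. -/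

import Mathlib

open scoped ContDiff

namespace AxiEuler

/-- The range `[π, 2π]` of the radial variable in the annular (Taylor–Couette) tank. -/
noncomputable def radii : Set ℝ := Set.Icc Real.pi (2 * Real.pi)

/-- The time interval `[0, T)`, where `T` may be `+∞`. -/
def times (T : EReal) : Set ℝ := {t | 0 ≤ t ∧ (t : EReal) < T}

/-- `f(r, z)` is a smooth function on `[π, 2π] × 𝕋`, smooth up to the boundary; a function on
`𝕋 = ℝ / 2πℤ` is a `2π`-periodic function on `ℝ`. -/
structure SmoothProfile (f : ℝ → ℝ → ℝ) : Prop where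
  smooth : ContDiffOn ℝ ∞ (fun q : ℝ × ℝ => f q.1 q.2) (radii ×ˢ Set.univ)
  periodic : ∀ r ∈ radii, ∀ z, f r (z + 2 * Real.pi) = f r z

/-- `f(t, r, z)` is smooth on `[0, T) × [π, 2π] × 𝕋`, up to the boundary and up to `t = 0`. -/
structure SmoothEvolution (T : EReal) (f : ℝ → ℝ → ℝ → ℝ) : Prop where
  smooth : ContDiffOn ℝ ∞ (fun q : ℝ × ℝ × ℝ => f q.1 q.2.1 q.2.2)
    (times T ×ˢ radii ×ˢ Set.univ)
  periodic : ∀ t ∈ times T, ∀ r ∈ radii, ∀ z, f t r (z + 2 * Real.pi) = f t r z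

/-- `∂_t f`, one-sided at `t = 0`. -/
noncomputable def dt (T : EReal) (f : ℝ → ℝ → ℝ → ℝ) (t r z : ℝ) : ℝ :=
  derivWithin (fun s => f s r z) (times T) t

/-- `∂_r f`, one-sided at `r = π` and `r = 2π`. -/
noncomputable def dr (f : ℝ → ℝ → ℝ → ℝ) (t r z : ℝ) : ℝ :=
  derivWithin (fun s => f t s z) radii r

/-- `∂_z f`. -/
noncomputable def dz (f : ℝ → ℝ → ℝ → ℝ) (t r z : ℝ) : ℝ :=
  deriv (fun s => f t r s) z

/-- The radial velocity `u^r = -(1/r) ∂_z ψ` of the stream function `ψ`. -/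
noncomputable def ur (ψ : ℝ → ℝ → ℝ → ℝ) (t r z : ℝ) : ℝ := (1 / r) * -(dz ψ t r z)

/-- The vertical velocity `u^z = (1/r) ∂_r ψ` of the stream function `ψ`. -/
noncomputable def uz (ψ : ℝ → ℝ → ℝ → ℝ) (t r z : ℝ) : ℝ := (1 / r) * dr ψ t r z

/-- The material derivative `D_t f = ∂_t f + u^r ∂_r f + u^z ∂_z f`. -/
noncomputable def materialDeriv (T : EReal) (ψ f : ℝ → ℝ → ℝ → ℝ) (t r z : ℝ) : ℝ :=
  dt T f t r z + ur ψ t r z * dr f t r z + uz ψ t r z * dz f t r z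

/-- `(u^θ, ω^θ)`, with stream function `ψ`, is a smooth solution on `[0, T)` of the 3D axisymmetric
Euler equation in the annular tank `r ∈ [π, 2π]`, periodic in `z`, with initial data
`(u^θ₀, ω^θ₀)`. The stream function of the Biot–Savart law vanishes on both walls; this contains
the no-penetration condition `u^r = 0` there. -/
structure IsSmoothSolution (T : EReal) (uθ₀ ωθ₀ : ℝ → ℝ → ℝ) (uθ ωθ ψ : ℝ → ℝ → ℝ → ℝ) :
    Prop where
  smooth_uθ : SmoothEvolution T uθ
  smooth_ωθ : SmoothEvolution T ωθ
  smooth_ψ : SmoothEvolution T ψ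
  /-- `D_t (r u^θ) = 0`. -/
  swirl : ∀ t ∈ times T, ∀ r ∈ radii, ∀ z,
    materialDeriv T ψ (fun t r z => r * uθ t r z) t r z = 0
  /-- `D_t (ω^θ / r) = ∂_z (r u^θ)² / r⁴`. -/
  vorticity : ∀ t ∈ times T, ∀ r ∈ radii, ∀ z,
    materialDeriv T ψ (fun t r z => ωθ t r z / r) t r z
      = dz (fun t r z => (r * uθ t r z) ^ 2) t r z / r ^ 4
  /-- `-(1/r) ∂_r ((1/r) ∂_r ψ) - (1/r²) ∂_z² ψ = ω^θ / r`. -/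
  biotSavart : ∀ t ∈ times T, ∀ r ∈ radii, ∀ z,
    -(1 / r) * dr (fun t r z => (1 / r) * dr ψ t r z) t r z - (1 / r ^ 2) * dz (dz ψ) t r z
      = ωθ t r z / r
  inner_wall : ∀ t ∈ times T, ∀ z, ψ t Real.pi z = 0
  outer_wall : ∀ t ∈ times T, ∀ z, ψ t (2 * Real.pi) z = 0
  init_uθ : ∀ r ∈ radii, ∀ z, uθ 0 r z = uθ₀ r z
  init_ωθ : ∀ r ∈ radii, ∀ z, ωθ 0 r z = ωθ₀ r z

/-- The volume `r dr dθ dz` of the tank `Ω = {r ∈ [π, 2π], θ ∈ 𝕋, z ∈ 𝕋}` in cylindrical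
coordinates `(r, θ, z)`, with `𝕋` represented by `(-π, π]`. -/
noncomputable def tankVolume : MeasureTheory.Measure (ℝ × ℝ × ℝ) :=
  (MeasureTheory.volume.restrict
    (radii ×ˢ Set.Ioc (-Real.pi) Real.pi ×ˢ Set.Ioc (-Real.pi) Real.pi)).withDensity
      (fun q => ENNReal.ofReal q.1)

/-- The norm in `L^p(Ω)` of the axisymmetric field `f(r, z)`, with values in a normed space. -/
noncomputable def tankNorm {E : Type*} [NormedAddCommGroup E] (p : ENNReal) (f : ℝ → ℝ → E) :
    ENNReal :=
  MeasureTheory.eLpNorm (fun q : ℝ × ℝ × ℝ => f q.1 q.2.2) p tankVolume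

/-- The velocity `u = u^r e_r + u^θ e_θ + u^z e_z` at time `t`, by its components in the
orthonormal frame `(e_r, e_θ, e_z)`. -/
noncomputable def velocity (uθ ψ : ℝ → ℝ → ℝ → ℝ) (t r z : ℝ) : EuclideanSpace ℝ (Fin 3) :=
  !₂[ur ψ t r z, uθ t r z, uz ψ t r z]

end AxiEuler

/-! The argument plays growth of circulation against conservation of energy. Since the swirl is even
and the vorticity odd in `z`, the reflected solution has the same initial data. An energy estimate
for the difference of two solutions, closed by Gronwall, makes `ψ` odd (`stream_add_reflect`), so
the planes `z = 0` and `z = π` are invariant. On such a plane `Γ = r u^θ` is merely transported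
radially, and its initial bounds persist (`angular_momentum_invariant`): `Γ² ≥ (πk₀)²` on `z = π`
and `Γ² ≤ (πk₀)²/16` on `z = 0`.

With respect to `dr dz`, `ω^θ` satisfies a conservation law. On the half period `0 ≤ z ≤ π` the
convective flux vanishes through all four sides, and only the flux of `Γ²/r³` through the two planes
remains. The total vorticity there therefore grows at a rate bounded below by a positive constant
(`integral_vorticity_ge`). By Stokes it equals the circulation around the half period, whose
perimeter is `4π`; this gives the linear bound on the velocity (`velocity_lower_bound`).

For the `L^p` bounds, the meridional kinetic energy stays bounded (`integral_velocity_sq_le`). In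
each of the four boundary strips of width `δ ~ t⁻²`, some line carries at most the average energy,
so by Cauchy–Schwarz the circulation along it is at most a small multiple of `t`. The rectangle cut
out by four such lines contains at most half of the available lower bound for the vorticity. The
remaining frame, of area `O(t⁻²)`, holds vorticity of order `t` (`exists_thin_layer`), and Hölder on
the frame yields `t · t^(2 - 2/p) = t^(3 - 2/p)`.

The same energy identity serves twice: compared with the fluid at rest it is exact conservation,
compared with the reflected solution it is uniqueness. -/

namespace AxiEuler

open Set MeasureTheory Filter Topology

section

/-! ### Calculus of smooth evolutions -/

/-- The domain `[0, T) × [π, 2π] × ℝ` of a smooth evolution. -/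
noncomputable def domain (T : EReal) : Set (ℝ × ℝ × ℝ) := times T ×ˢ radii ×ˢ Set.univ

variable {T : EReal}

lemma Icc_subset_times {b : ℝ} (hb : b ∈ times T) : Icc 0 b ⊆ times T := fun _ hs =>
  ⟨hs.1, lt_of_le_of_lt (EReal.coe_le_coe_iff.2 hs.2) hb.2⟩

lemma pi_mem_radii : Real.pi ∈ radii := ⟨le_rfl, by linarith [Real.pi_pos]⟩

lemma two_pi_mem_radii : 2 * Real.pi ∈ radii := ⟨by linarith [Real.pi_pos], le_rfl⟩

lemma pos_of_mem_radii {r : ℝ} (hr : r ∈ radii) : 0 < r := lt_of_lt_of_le Real.pi_pos hr.1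

lemma ne_zero_of_mem_radii {r : ℝ} (hr : r ∈ radii) : r ≠ 0 := (pos_of_mem_radii hr).ne'

lemma convex_times : Convex ℝ (times T) := by
  apply Set.OrdConnected.convex
  exact ⟨fun _ hx _ hy _ hz =>
    ⟨hx.1.trans hz.1, lt_of_le_of_lt (EReal.coe_le_coe_iff.2 hz.2) hy.2⟩⟩

lemma convex_domain : Convex ℝ (domain T) :=
  convex_times.prod ((convex_Icc _ _).prod convex_univ)

lemma exists_mem_times_gt {t : ℝ} (ht : t ∈ times T) : ∃ b ∈ times T, t < b := by
  obtain ⟨b, hb, hbT⟩ := EReal.lt_iff_exists_real_btwn.1 ht.2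
  have h : t < b := EReal.coe_lt_coe_iff.1 hb
  exact ⟨b, ⟨ht.1.trans h.le, hbT⟩, h⟩

lemma interior_times_nonempty {t : ℝ} (ht : t ∈ times T) : (interior (times T)).Nonempty := by
  obtain ⟨b, hb, htb⟩ := exists_mem_times_gt ht
  refine ⟨(0 + b) / 2, interior_mono (Icc_subset_times hb) ?_⟩
  rw [interior_Icc]
  constructor <;> linarith [ht.1]

lemma interior_domain_nonempty {t : ℝ} (ht : t ∈ times T) : (interior (domain T)).Nonempty := by
  rw [domain, interior_prod_eq, interior_prod_eq]
  refine (interior_times_nonempty ht).prod (Set.Nonempty.prod ?_ (by simp))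
  rw [radii, interior_Icc]
  exact nonempty_Ioo.2 (by linarith [Real.pi_pos])

lemma uniqueDiffOn_times : UniqueDiffOn ℝ (times T) := by
  intro t ht
  exact uniqueDiffOn_convex convex_times (interior_times_nonempty ht) t ht

lemma uniqueDiffOn_domain : UniqueDiffOn ℝ (domain T) := by
  intro q hq
  exact uniqueDiffOn_convex convex_domain (interior_domain_nonempty hq.1) q hq

lemma uniqueDiffOn_radii : UniqueDiffOn ℝ radii :=
  uniqueDiffOn_Icc (by linarith [Real.pi_pos])

/-- A function of `(t, r, z)` as a function of one variable. -/
def joint (f : ℝ → ℝ → ℝ → ℝ) (q : ℝ × ℝ × ℝ) : ℝ := f q.1 q.2.1 q.2.2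

namespace SmoothEvolution

variable {f g : ℝ → ℝ → ℝ → ℝ} {t r z : ℝ}

lemma contDiffOn (hf : SmoothEvolution T f) : ContDiffOn ℝ ∞ (joint f) (domain T) := hf.smooth

lemma hasFDerivWithinAt (hf : SmoothEvolution T f) (ht : t ∈ times T) (hr : r ∈ radii) :
    HasFDerivWithinAt (joint f) (fderivWithin ℝ (joint f) (domain T) (t, r, z)) (domain T)
      (t, r, z) :=
  ((hf.contDiffOn.differentiableOn (by simp)) _ ⟨ht, hr, mem_univ _⟩).hasFDerivWithinAt

lemma hasDerivWithinAt_t_aux (hf : SmoothEvolution T f) (ht : t ∈ times T) (hr : r ∈ radii) :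
    HasDerivWithinAt (fun s => f s r z)
      (fderivWithin ℝ (joint f) (domain T) (t, r, z) (1, 0, 0)) (times T) t := by
  have h1 : HasDerivWithinAt (fun s : ℝ => (s, r, z)) ((1 : ℝ), (0 : ℝ), (0 : ℝ)) (times T) t :=
    (hasDerivWithinAt_id t _).prodMk ((hasDerivWithinAt_const _ _ _).prodMk
      (hasDerivWithinAt_const _ _ _))
  exact (hf.hasFDerivWithinAt ht hr (z := z)).comp_hasDerivWithinAt t h1
    (t := domain T) (fun s hs => by exact ⟨hs, hr, mem_univ _⟩)

lemma hasDerivWithinAt_r_aux (hf : SmoothEvolution T f) (ht : t ∈ times T) (hr : r ∈ radii) :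
    HasDerivWithinAt (fun s => f t s z)
      (fderivWithin ℝ (joint f) (domain T) (t, r, z) (0, 1, 0)) radii r := by
  have h1 : HasDerivWithinAt (fun s : ℝ => (t, s, z)) ((0 : ℝ), (1 : ℝ), (0 : ℝ)) radii r :=
    (hasDerivWithinAt_const _ _ _).prodMk ((hasDerivWithinAt_id r _).prodMk
      (hasDerivWithinAt_const _ _ _))
  exact (hf.hasFDerivWithinAt ht hr (z := z)).comp_hasDerivWithinAt r h1
    (t := domain T) (fun s hs => by exact ⟨ht, hs, mem_univ _⟩)

lemma hasDerivAt_z_aux (hf : SmoothEvolution T f) (ht : t ∈ times T) (hr : r ∈ radii) :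
    HasDerivAt (fun s => f t r s)
      (fderivWithin ℝ (joint f) (domain T) (t, r, z) (0, 0, 1)) z := by
  have h1 : HasDerivWithinAt (fun s : ℝ => (t, r, s)) ((0 : ℝ), (0 : ℝ), (1 : ℝ)) univ z :=
    (hasDerivWithinAt_const _ _ _).prodMk ((hasDerivWithinAt_const _ _ _).prodMk
      (hasDerivWithinAt_id z _))
  rw [← hasDerivWithinAt_univ]
  exact (hf.hasFDerivWithinAt ht hr (z := z)).comp_hasDerivWithinAt z h1
    (t := domain T) (fun s hs => by exact ⟨ht, hr, mem_univ _⟩)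

lemma dt_eq_fderivWithin (hf : SmoothEvolution T f) (ht : t ∈ times T) (hr : r ∈ radii) :
    dt T f t r z = fderivWithin ℝ (joint f) (domain T) (t, r, z) (1, 0, 0) :=
  (hf.hasDerivWithinAt_t_aux ht hr).derivWithin (uniqueDiffOn_times t ht)

lemma dr_eq_fderivWithin (hf : SmoothEvolution T f) (ht : t ∈ times T) (hr : r ∈ radii) :
    dr f t r z = fderivWithin ℝ (joint f) (domain T) (t, r, z) (0, 1, 0) :=
  (hf.hasDerivWithinAt_r_aux ht hr).derivWithin (uniqueDiffOn_radii r hr)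

lemma dz_eq_fderivWithin (hf : SmoothEvolution T f) (ht : t ∈ times T) (hr : r ∈ radii) :
    dz f t r z = fderivWithin ℝ (joint f) (domain T) (t, r, z) (0, 0, 1) :=
  (hf.hasDerivAt_z_aux ht hr).deriv

lemma hasDerivWithinAt_t (hf : SmoothEvolution T f) (ht : t ∈ times T) (hr : r ∈ radii) (z : ℝ) :
    HasDerivWithinAt (fun s => f s r z) (dt T f t r z) (times T) t := by
  rw [hf.dt_eq_fderivWithin ht hr]; exact hf.hasDerivWithinAt_t_aux ht hr

lemma hasDerivWithinAt_r (hf : SmoothEvolution T f) (ht : t ∈ times T) (hr : r ∈ radii) (z : ℝ) :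
    HasDerivWithinAt (fun s => f t s z) (dr f t r z) radii r := by
  rw [hf.dr_eq_fderivWithin ht hr]; exact hf.hasDerivWithinAt_r_aux ht hr

lemma hasDerivAt_z (hf : SmoothEvolution T f) (ht : t ∈ times T) (hr : r ∈ radii) (z : ℝ) :
    HasDerivAt (fun s => f t r s) (dz f t r z) z := by
  rw [hf.dz_eq_fderivWithin ht hr]; exact hf.hasDerivAt_z_aux ht hr

lemma contDiffOn_fderivWithin_apply (hf : SmoothEvolution T f) (v : ℝ × ℝ × ℝ) :
    ContDiffOn ℝ ∞ (fun q => fderivWithin ℝ (joint f) (domain T) q v) (domain T) :=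
  (hf.contDiffOn.fderivWithin uniqueDiffOn_domain (by simp)).clm_apply contDiffOn_const

protected lemma dt (hf : SmoothEvolution T f) : SmoothEvolution T (dt T f) where
  smooth := (hf.contDiffOn_fderivWithin_apply (1, 0, 0)).congr fun _ hq =>
    hf.dt_eq_fderivWithin hq.1 hq.2.1
  periodic t ht r hr z :=
    derivWithin_congr (fun s hs => hf.periodic s hs r hr z) (hf.periodic t ht r hr z)

protected lemma dr (hf : SmoothEvolution T f) : SmoothEvolution T (dr f) where
  smooth := (hf.contDiffOn_fderivWithin_apply (0, 1, 0)).congr fun _ hq =>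
    hf.dr_eq_fderivWithin hq.1 hq.2.1
  periodic t ht r hr z :=
    derivWithin_congr (fun s hs => hf.periodic t ht s hs z) (hf.periodic t ht r hr z)

protected lemma dz (hf : SmoothEvolution T f) : SmoothEvolution T (dz f) where
  smooth := (hf.contDiffOn_fderivWithin_apply (0, 0, 1)).congr fun _ hq =>
    hf.dz_eq_fderivWithin hq.1 hq.2.1
  periodic t ht r hr z := by
    have h : (fun s => f t r (s + 2 * Real.pi)) = fun s => f t r s :=
      funext fun s => hf.periodic t ht r hr s
    rw [dz, ← deriv_comp_add_const, h, dz]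

/-- The domain is convex with nonempty interior, so each of its points, even on the walls or at `t =
0`, is a limit of interior points, where second derivatives commute. Evaluating on coordinate
vectors gives the commutation rules for `dt`, `dr` and `dz`. -/
lemma isSymm (hf : SmoothEvolution T f) (ht : t ∈ times T) (hr : r ∈ radii) (v w : ℝ × ℝ × ℝ) :
    fderivWithin ℝ (fun q => fderivWithin ℝ (joint f) (domain T) q v) (domain T) (t, r, z) w =
    fderivWithin ℝ (fun q => fderivWithin ℝ (joint f) (domain T) q w) (domain T) (t, r, z) v := by
  have hq : (t, r, z) ∈ domain T := ⟨ht, hr, mem_univ _⟩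
  have hd : DifferentiableWithinAt ℝ (fderivWithin ℝ (joint f) (domain T)) (domain T) (t, r, z) :=
    (hf.contDiffOn.fderivWithin (m := 1) uniqueDiffOn_domain (by norm_cast)).differentiableOn
      (by simp) _ hq
  have hs : IsSymmSndFDerivWithinAt ℝ (joint f) (domain T) (t, r, z) := by
    refine (hf.contDiffOn _ hq).isSymmSndFDerivWithinAt (by simp; norm_cast) uniqueDiffOn_domain ?_ hq
    rw [convex_domain.closure_interior_eq_closure_of_nonempty_interior
      (interior_domain_nonempty ht)]
    exact subset_closure hq
  have h (v : ℝ × ℝ × ℝ) : fderivWithin ℝ (fun q => fderivWithin ℝ (joint f) (domain T) q v)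
      (domain T) (t, r, z) =
      (fderivWithin ℝ (fderivWithin ℝ (joint f) (domain T)) (domain T) (t, r, z)).flip v := by
    have := hd.hasFDerivWithinAt.clm_apply
      (hasFDerivWithinAt_const v (t, r, z) (domain T))
    rw [this.fderivWithin (uniqueDiffOn_domain _ hq)]
    simp
  rw [h, h]
  exact hs w v

lemma dr_dz (hf : SmoothEvolution T f) (ht : t ∈ times T) (hr : r ∈ radii) (z : ℝ) :
    dr (dz f) t r z = dz (dr f) t r z := by
  have hq : (t, r, z) ∈ domain T := ⟨ht, hr, mem_univ _⟩
  rw [hf.dz.dr_eq_fderivWithin ht hr, hf.dr.dz_eq_fderivWithin ht hr,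
    fderivWithin_congr'
      (f₁ := joint (dz f)) (f := fun q => fderivWithin ℝ (joint f) (domain T) q (0, 0, 1))
      (fun q hq => hf.dz_eq_fderivWithin hq.1 hq.2.1) hq,
    fderivWithin_congr'
      (f₁ := joint (dr f)) (f := fun q => fderivWithin ℝ (joint f) (domain T) q (0, 1, 0))
      (fun q hq => hf.dr_eq_fderivWithin hq.1 hq.2.1) hq]
  exact hf.isSymm ht hr _ _

lemma dr_dt (hf : SmoothEvolution T f) (ht : t ∈ times T) (hr : r ∈ radii) (z : ℝ) :
    dr (AxiEuler.dt T f) t r z = AxiEuler.dt T (dr f) t r z := by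
  have hq : (t, r, z) ∈ domain T := ⟨ht, hr, mem_univ _⟩
  rw [hf.dt.dr_eq_fderivWithin ht hr, hf.dr.dt_eq_fderivWithin ht hr,
    fderivWithin_congr'
      (f₁ := joint (AxiEuler.dt T f)) (f := fun q => fderivWithin ℝ (joint f) (domain T) q (1, 0, 0))
      (fun q hq => hf.dt_eq_fderivWithin hq.1 hq.2.1) hq,
    fderivWithin_congr'
      (f₁ := joint (dr f)) (f := fun q => fderivWithin ℝ (joint f) (domain T) q (0, 1, 0))
      (fun q hq => hf.dr_eq_fderivWithin hq.1 hq.2.1) hq]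
  exact hf.isSymm ht hr _ _

lemma dz_dt (hf : SmoothEvolution T f) (ht : t ∈ times T) (hr : r ∈ radii) (z : ℝ) :
    dz (AxiEuler.dt T f) t r z = AxiEuler.dt T (dz f) t r z := by
  have hq : (t, r, z) ∈ domain T := ⟨ht, hr, mem_univ _⟩
  rw [hf.dt.dz_eq_fderivWithin ht hr, hf.dz.dt_eq_fderivWithin ht hr,
    fderivWithin_congr'
      (f₁ := joint (AxiEuler.dt T f)) (f := fun q => fderivWithin ℝ (joint f) (domain T) q (1, 0, 0))
      (fun q hq => hf.dt_eq_fderivWithin hq.1 hq.2.1) hq,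
    fderivWithin_congr'
      (f₁ := joint (dz f)) (f := fun q => fderivWithin ℝ (joint f) (domain T) q (0, 0, 1))
      (fun q hq => hf.dz_eq_fderivWithin hq.1 hq.2.1) hq]
  exact hf.isSymm ht hr _ _

lemma add (hf : SmoothEvolution T f) (hg : SmoothEvolution T g) :
    SmoothEvolution T (fun t r z => f t r z + g t r z) :=
  ⟨hf.smooth.add hg.smooth, fun t ht r hr z => by
    rw [hf.periodic t ht r hr, hg.periodic t ht r hr]⟩

lemma sub (hf : SmoothEvolution T f) (hg : SmoothEvolution T g) :
    SmoothEvolution T (fun t r z => f t r z - g t r z) :=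
  ⟨hf.smooth.sub hg.smooth, fun t ht r hr z => by
    rw [hf.periodic t ht r hr, hg.periodic t ht r hr]⟩

lemma mul (hf : SmoothEvolution T f) (hg : SmoothEvolution T g) :
    SmoothEvolution T (fun t r z => f t r z * g t r z) :=
  ⟨hf.smooth.mul hg.smooth, fun t ht r hr z => by
    rw [hf.periodic t ht r hr, hg.periodic t ht r hr]⟩

lemma neg (hf : SmoothEvolution T f) : SmoothEvolution T (fun t r z => -f t r z) :=
  ⟨hf.smooth.neg, fun t ht r hr z => by rw [hf.periodic t ht r hr]⟩

lemma pow (hf : SmoothEvolution T f) (n : ℕ) : SmoothEvolution T (fun t r z => f t r z ^ n) :=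
  ⟨hf.smooth.pow n, fun t ht r hr z => by rw [hf.periodic t ht r hr]⟩

lemma const (c : ℝ) : SmoothEvolution T (fun _ _ _ => c) :=
  ⟨contDiffOn_const, fun _ _ _ _ _ => rfl⟩

lemma radius : SmoothEvolution T (fun _ r _ => r) :=
  ⟨(contDiff_fst.comp contDiff_snd).contDiffOn, fun _ _ _ _ _ => rfl⟩

lemma div (hf : SmoothEvolution T f) (hg : SmoothEvolution T g)
    (h : ∀ t ∈ times T, ∀ r ∈ radii, ∀ z, g t r z ≠ 0) :
    SmoothEvolution T (fun t r z => f t r z / g t r z) :=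
  ⟨hf.smooth.div hg.smooth (fun q hq => h _ hq.1 _ hq.2.1 _), fun t ht r hr z => by
    rw [hf.periodic t ht r hr, hg.periodic t ht r hr]⟩

lemma div_radius (hf : SmoothEvolution T f) : SmoothEvolution T (fun t r z => f t r z / r) :=
  hf.div radius fun _ _ _ hr _ => ne_zero_of_mem_radii hr

lemma div_radius_pow (hf : SmoothEvolution T f) (n : ℕ) :
    SmoothEvolution T (fun t r z => f t r z / r ^ n) :=
  hf.div (radius.pow n) fun _ _ _ hr _ => pow_ne_zero _ (ne_zero_of_mem_radii hr)

lemma comp {h : ℝ → ℝ} (hh : ContDiff ℝ ∞ h) (hf : SmoothEvolution T f) :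
    SmoothEvolution T (fun t r z => h (f t r z)) :=
  ⟨hh.comp_contDiffOn hf.smooth, fun t ht r hr z => by rw [hf.periodic t ht r hr]⟩

lemma comp_neg (hf : SmoothEvolution T f) : SmoothEvolution T (fun t r z => f t r (-z)) where
  smooth := by
    have : ContDiff ℝ ∞ (fun q : ℝ × ℝ × ℝ => (q.1, q.2.1, -q.2.2)) := by fun_prop
    exact hf.smooth.comp this.contDiffOn (fun q hq => ⟨hq.1, hq.2.1, mem_univ _⟩)
  periodic t ht r hr z := by
    have := hf.periodic t ht r hr (-(z + 2 * Real.pi))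
    rw [← this]; congr 1; ring

lemma continuousOn (hf : SmoothEvolution T f) : ContinuousOn (joint f) (domain T) :=
  hf.contDiffOn.continuousOn

lemma continuousOn_slice (hf : SmoothEvolution T f) (ht : t ∈ times T) :
    ContinuousOn (fun x : ℝ × ℝ => f t x.1 x.2) (radii ×ˢ univ) :=
  hf.continuousOn.comp (f := fun x : ℝ × ℝ => (t, x.1, x.2)) (by fun_prop)
    fun _ hx => ⟨ht, hx.1, mem_univ _⟩

end SmoothEvolution

end

section

/-! ### Integration over rectangles -/

lemma integral_Icc_prod {f : ℝ × ℝ → ℝ} {r₁ r₂ z₁ z₂ : ℝ} (hr : r₁ ≤ r₂) (hz : z₁ ≤ z₂)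
    (hf : ContinuousOn f (Icc r₁ r₂ ×ˢ Icc z₁ z₂)) :
    ∫ x in Icc r₁ r₂ ×ˢ Icc z₁ z₂, f x = ∫ r in r₁..r₂, ∫ z in z₁..z₂, f (r, z) := by
  rw [Measure.volume_eq_prod, setIntegral_prod, intervalIntegral.integral_of_le hr,
    integral_Icc_eq_integral_Ioc]
  · simp_rw [intervalIntegral.integral_of_le hz, integral_Icc_eq_integral_Ioc]
  · exact hf.integrableOn_compact (isCompact_Icc.prod isCompact_Icc)

lemma integral_Icc_prod_swap {f : ℝ × ℝ → ℝ} {r₁ r₂ z₁ z₂ : ℝ} (hr : r₁ ≤ r₂) (hz : z₁ ≤ z₂)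
    (hf : ContinuousOn f (Icc r₁ r₂ ×ˢ Icc z₁ z₂)) :
    ∫ x in Icc r₁ r₂ ×ˢ Icc z₁ z₂, f x = ∫ z in z₁..z₂, ∫ r in r₁..r₂, f (r, z) := by
  have h := integral_Icc_prod (f := fun x => f x.swap) hz hr
    (hf.comp continuous_swap.continuousOn fun x hx => ⟨hx.2, hx.1⟩)
  simp only [Prod.swap_prod_mk] at h
  rw [← h, Measure.volume_eq_prod, ← setIntegral_prod_swap]

/-- Differentiation under the integral sign over a compact set, on a compact interval. -/
lemma hasDerivWithinAt_setIntegral {X : Type*} [TopologicalSpace X] [MeasurableSpace X]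
    [OpensMeasurableSpace X] [T2Space X] [SecondCountableTopologyEither X ℝ]
    {μ : Measure X} [IsFiniteMeasureOnCompacts μ] {K : Set X} (hK : IsCompact K)
    {a b t : ℝ} (ht : t ∈ Icc a b) {f f' : ℝ → X → ℝ}
    (hf : ∀ s ∈ Icc a b, ContinuousOn (f s) K)
    (hf' : ContinuousOn (fun q : ℝ × X => f' q.1 q.2) (Icc a b ×ˢ K))
    (hd : ∀ s ∈ Icc a b, ∀ x ∈ K, HasDerivWithinAt (fun s => f s x) (f' s x) (Icc a b) s) :
    HasDerivWithinAt (fun s => ∫ x in K, f s x ∂μ) (∫ x in K, f' t x ∂μ) (Icc a b) t := by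
  obtain ⟨M, hM⟩ := (isCompact_Icc.prod hK).exists_bound_of_continuousOn hf'
  have hint (s) (hs : s ∈ Icc a b) : IntegrableOn (f s) K μ := (hf s hs).integrableOn_compact hK
  have hKm : MeasurableSet K := hK.measurableSet
  rw [hasDerivWithinAt_iff_tendsto_slope]
  have hmem : ∀ᶠ s in 𝓝[Icc a b \ {t}] t, s ∈ Icc a b \ {t} := self_mem_nhdsWithin
  have key : Tendsto (fun s => ∫ x in K, slope (fun s => f s x) t s ∂μ) (𝓝[Icc a b \ {t}] t)
      (𝓝 (∫ x in K, f' t x ∂μ)) := by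
    refine tendsto_integral_filter_of_dominated_convergence (fun _ => M) ?_ ?_ ?_ ?_
    · filter_upwards [hmem] with s hs
      simp only [slope_def_field]
      exact ((hint s hs.1).sub (hint t ht)).aestronglyMeasurable.mul_const _
    · filter_upwards [hmem] with s hs
      refine (ae_restrict_mem hKm).mono fun x hx => ?_
      have := (convex_Icc a b).norm_image_sub_le_of_norm_hasDerivWithin_le
        (fun s hs => hd s hs x hx) (fun s hs => hM (s, x) ⟨hs, hx⟩) ht hs.1
      rw [slope_def_field, norm_div]
      exact div_le_of_le_mul₀ (norm_nonneg _)
        ((norm_nonneg _).trans (hM (t, x) ⟨ht, hx⟩)) this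
    · exact integrableOn_const hK.measure_lt_top.ne
    · refine (ae_restrict_mem hKm).mono fun x hx => ?_
      exact hasDerivWithinAt_iff_tendsto_slope.1 (hd t ht x hx)
  refine key.congr' ?_
  filter_upwards [hmem] with s hs
  simp only [slope_def_field]
  rw [integral_div, integral_sub (hint s hs.1) (hint t ht)]

/-- Gronwall's inequality without inhomogeneity. With `K = 0` it says that the quantity does not
grow; with `F 0 = 0`, that it vanishes. -/
lemma abs_le_of_abs_deriv_le {F F' : ℝ → ℝ} {K b : ℝ}
    (hF : ∀ s ∈ Icc 0 b, HasDerivWithinAt F (F' s) (Icc 0 b) s)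
    (hK : ∀ s ∈ Icc 0 b, |F' s| ≤ K * |F s|) :
    ∀ s ∈ Icc 0 b, |F s| ≤ |F 0| * Real.exp (K * s) := by
  intro s hs
  have h := norm_le_gronwallBound_of_norm_deriv_right_le (f := F) (f' := F') (δ := |F 0|) (K := K)
    (ε := 0) (a := 0) (b := b) (fun s hs => (hF s hs).continuousWithinAt)
    (fun s hs => ((hF s ⟨hs.1, hs.2.le⟩).mono_of_mem_nhdsWithin
      (Icc_mem_nhdsGE_of_mem hs))) le_rfl
    (fun s hs => by simpa using hK s ⟨hs.1, hs.2.le⟩) s hs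
  simpa [gronwallBound_ε0] using h

/-- A continuous nonnegative function with zero integral over a set that is the closure of its
interior vanishes. -/
lemma eq_zero_of_setIntegral_eq_zero {X : Type*} [TopologicalSpace X] [MeasurableSpace X]
    [OpensMeasurableSpace X] [T2Space X]
    {μ : Measure X} [IsFiniteMeasureOnCompacts μ] [μ.IsOpenPosMeasure] {K : Set X}
    (hK : IsCompact K) (hKi : K ⊆ closure (interior K)) {f : X → ℝ} (hf : ContinuousOn f K)
    (h0 : ∀ x ∈ K, 0 ≤ f x) (hi : ∫ x in K, f x ∂μ = 0) : ∀ x ∈ K, f x = 0 := by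
  have h := (setIntegral_eq_zero_iff_of_nonneg_ae
    ((ae_restrict_mem hK.measurableSet).mono fun x hx => h0 x hx)
    (hf.integrableOn_compact hK)).1 hi
  exact Measure.eqOn_of_ae_eq h hf continuousOn_const hKi

/-- One period `[π, 2π] × [-π, π]` of the tank. -/
noncomputable def cell : Set (ℝ × ℝ) := radii ×ˢ Icc (-Real.pi) Real.pi

lemma isCompact_radii : IsCompact radii := isCompact_Icc

lemma isCompact_cell : IsCompact cell := isCompact_Icc.prod isCompact_Icc

lemma radii_subset_closure_interior : radii ⊆ closure (interior radii) := by
  rw [radii, interior_Icc, closure_Ioo (by linarith [Real.pi_pos])]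

lemma cell_subset_closure_interior : cell ⊆ closure (interior cell) := by
  rw [cell, radii, interior_prod_eq, closure_prod_eq, interior_Icc, interior_Icc,
    closure_Ioo (by linarith [Real.pi_pos]), closure_Ioo (by linarith [Real.pi_pos])]

variable {T : EReal} {f g : ℝ → ℝ → ℝ → ℝ} {t b : ℝ}

namespace SmoothEvolution

lemma continuousOn_of_subset (hf : SmoothEvolution T f) (ht : t ∈ times T) {K : Set (ℝ × ℝ)}
    (hK : K ⊆ radii ×ˢ univ) : ContinuousOn (fun x : ℝ × ℝ => f t x.1 x.2) K :=
  (hf.continuousOn_slice ht).mono hK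

lemma integrableOn (hf : SmoothEvolution T f) (ht : t ∈ times T) {K : Set (ℝ × ℝ)}
    (hKc : IsCompact K) (hK : K ⊆ radii ×ˢ univ) :
    IntegrableOn (fun x : ℝ × ℝ => f t x.1 x.2) K :=
  (hf.continuousOn_of_subset ht hK).integrableOn_compact hKc

lemma continuousOn_r (hf : SmoothEvolution T f) (ht : t ∈ times T) (z : ℝ) :
    ContinuousOn (fun r => f t r z) radii :=
  (hf.continuousOn_slice ht).comp (f := fun r => (r, z)) (by fun_prop)
    fun _ hr => ⟨hr, mem_univ _⟩

lemma continuous_z (hf : SmoothEvolution T f) (ht : t ∈ times T) {r : ℝ} (hr : r ∈ radii) :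
    Continuous (fun z => f t r z) := by
  rw [← continuousOn_univ]
  exact (hf.continuousOn_slice ht).comp (f := fun z => (r, z)) (by fun_prop)
    fun _ hr' => ⟨hr, mem_univ _⟩

lemma integral_dr_line (hf : SmoothEvolution T f) (ht : t ∈ times T) {r₁ r₂ : ℝ}
    (h₁ : r₁ ∈ radii) (h₂ : r₂ ∈ radii) (h : r₁ ≤ r₂) (z : ℝ) :
    ∫ r in r₁..r₂, dr f t r z = f t r₂ z - f t r₁ z := by
  have hs : Icc r₁ r₂ ⊆ radii := Icc_subset_Icc h₁.1 h₂.2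
  refine intervalIntegral.integral_eq_sub_of_hasDerivAt_of_le h
    ((hf.continuousOn_r ht z).mono hs) (fun r hr => ?_)
    (((hf.dr.continuousOn_r ht z).mono hs).intervalIntegrable_of_Icc h)
  exact (hf.hasDerivWithinAt_r ht (hs ⟨hr.1.le, hr.2.le⟩) z).hasDerivAt
    (Icc_mem_nhds (lt_of_le_of_lt h₁.1 hr.1) (lt_of_lt_of_le hr.2 h₂.2))

lemma integral_dz_line (hf : SmoothEvolution T f) (ht : t ∈ times T) {r : ℝ} (hr : r ∈ radii)
    (z₁ z₂ : ℝ) : ∫ z in z₁..z₂, dz f t r z = f t r z₂ - f t r z₁ :=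
  intervalIntegral.integral_eq_sub_of_hasDerivAt (fun z _ => hf.hasDerivAt_z ht hr z)
    ((hf.dz.continuous_z ht hr).intervalIntegrable _ _)

lemma integral_dr (hf : SmoothEvolution T f) (ht : t ∈ times T) {r₁ r₂ z₁ z₂ : ℝ}
    (h₁ : r₁ ∈ radii) (h₂ : r₂ ∈ radii) (h : r₁ ≤ r₂) (hz : z₁ ≤ z₂) :
    ∫ x in Icc r₁ r₂ ×ˢ Icc z₁ z₂, dr f t x.1 x.2 = ∫ z in z₁..z₂, (f t r₂ z - f t r₁ z) := by
  rw [integral_Icc_prod_swap h hz (hf.dr.continuousOn_of_subset ht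
    (prod_mono (Icc_subset_Icc h₁.1 h₂.2) (subset_univ _)))]
  simp_rw [hf.integral_dr_line ht h₁ h₂ h]

lemma integral_dz (hf : SmoothEvolution T f) (ht : t ∈ times T) {r₁ r₂ z₁ z₂ : ℝ}
    (h₁ : r₁ ∈ radii) (h₂ : r₂ ∈ radii) (h : r₁ ≤ r₂) (hz : z₁ ≤ z₂) :
    ∫ x in Icc r₁ r₂ ×ˢ Icc z₁ z₂, dz f t x.1 x.2 = ∫ r in r₁..r₂, (f t r z₂ - f t r z₁) := by
  rw [integral_Icc_prod h hz (hf.dz.continuousOn_of_subset ht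
    (prod_mono (Icc_subset_Icc h₁.1 h₂.2) (subset_univ _)))]
  refine intervalIntegral.integral_congr fun r hr => ?_
  rw [uIcc_of_le h] at hr
  exact hf.integral_dz_line ht (Icc_subset_Icc h₁.1 h₂.2 hr) _ _

lemma integral_cell_dr (hf : SmoothEvolution T f) (ht : t ∈ times T)
    (h₁ : ∀ z, f t Real.pi z = 0) (h₂ : ∀ z, f t (2 * Real.pi) z = 0) :
    ∫ x in cell, dr f t x.1 x.2 = 0 := by
  rw [cell, radii, hf.integral_dr ht pi_mem_radii two_pi_mem_radii (by linarith [Real.pi_pos])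
    (by linarith [Real.pi_pos])]
  simp [h₁, h₂]

lemma integral_cell_dz (hf : SmoothEvolution T f) (ht : t ∈ times T) :
    ∫ x in cell, dz f t x.1 x.2 = 0 := by
  rw [cell, radii, hf.integral_dz ht pi_mem_radii two_pi_mem_radii (by linarith [Real.pi_pos])
    (by linarith [Real.pi_pos])]
  have h : ∀ r ∈ radii, f t r Real.pi - f t r (-Real.pi) = 0 := fun r hr => by
    rw [← hf.periodic t ht r hr (-Real.pi)]; ring_nf
  rw [intervalIntegral.integral_congr (g := fun _ => 0)]
  · simp
  · intro r hr
    rw [uIcc_of_le (by linarith [Real.pi_pos])] at hr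
    exact h r hr

lemma hasDerivWithinAt_integral (hf : SmoothEvolution T f) {K : Set (ℝ × ℝ)} (hKc : IsCompact K)
    (hK : K ⊆ radii ×ˢ univ) (hb : b ∈ times T) (ht : t ∈ Icc 0 b) :
    HasDerivWithinAt (fun s => ∫ x in K, f s x.1 x.2) (∫ x in K, dt T f t x.1 x.2)
      (Icc 0 b) t :=
  hasDerivWithinAt_setIntegral hKc ht
    (fun _ hs => hf.continuousOn_of_subset (Icc_subset_times hb hs) hK)
    (hf.dt.continuousOn.mono (prod_mono (Icc_subset_times hb) hK))
    (fun _ hs x hx => (hf.hasDerivWithinAt_t (Icc_subset_times hb hs) (hK hx).1 x.2).mono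
      (Icc_subset_times hb))

lemma hasDerivWithinAt_integral_line (hf : SmoothEvolution T f) (hb : b ∈ times T)
    (ht : t ∈ Icc 0 b) (z : ℝ) :
    HasDerivWithinAt (fun s => ∫ r in radii, f s r z) (∫ r in radii, dt T f t r z)
      (Icc 0 b) t :=
  hasDerivWithinAt_setIntegral isCompact_radii ht
    (fun s hs => hf.continuousOn_r (Icc_subset_times hb hs) z)
    (hf.dt.continuousOn.comp (f := fun q : ℝ × ℝ => (q.1, q.2, z)) (by fun_prop)
      fun q hq => ⟨Icc_subset_times hb hq.1, hq.2, mem_univ _⟩)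
    (fun s hs r hr => (hf.hasDerivWithinAt_t (Icc_subset_times hb hs) hr z).mono
      (Icc_subset_times hb))

lemma exists_bound (hf : SmoothEvolution T f) (hb : b ∈ times T) (z₁ z₂ : ℝ) :
    ∃ M, 0 ≤ M ∧ ∀ s ∈ Icc 0 b, ∀ r ∈ radii, ∀ z ∈ Icc z₁ z₂, |f s r z| ≤ M := by
  obtain ⟨M, hM⟩ := (isCompact_Icc.prod (isCompact_radii.prod isCompact_Icc)).exists_bound_of_continuousOn
    (hf.continuousOn.mono (prod_mono (Icc_subset_times hb)
      (prod_mono subset_rfl (subset_univ (Icc z₁ z₂)))))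
  exact ⟨max M 0, le_max_right _ _, fun s hs r hr z hz =>
    (hM (s, r, z) ⟨hs, hr, hz⟩).trans (le_max_left _ _)⟩

end SmoothEvolution

lemma cell_subset : cell ⊆ radii ×ˢ univ := prod_mono subset_rfl (subset_univ _)

end

section

/-! ### The energy of a perturbation of a solution -/

/-- The perturbation of a solution with stream function `a` and angular momentum `g`: the stream
function `φ`, the angular momentum `γ` and the relative vorticity `d` are differences of those of
two solutions, `w` is the relative vorticity of the perturbed solution, and `(p, q) = ∇φ / r`. -/
structure IsPerturbation (T : EReal) (φ γ a g w d p q : ℝ → ℝ → ℝ → ℝ) : Prop where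
  smooth_φ : SmoothEvolution T φ
  smooth_γ : SmoothEvolution T γ
  smooth_a : SmoothEvolution T a
  smooth_g : SmoothEvolution T g
  smooth_w : SmoothEvolution T w
  smooth_d : SmoothEvolution T d
  smooth_p : SmoothEvolution T p
  smooth_q : SmoothEvolution T q
  dr_φ : ∀ t ∈ times T, ∀ r ∈ radii, ∀ z, dr φ t r z = r * p t r z
  dz_φ : ∀ t ∈ times T, ∀ r ∈ radii, ∀ z, dz φ t r z = r * q t r z
  elliptic : ∀ t ∈ times T, ∀ r ∈ radii, ∀ z, dr p t r z + dz q t r z = -(r * d t r z)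
  dt_γ : ∀ t ∈ times T, ∀ r ∈ radii, ∀ z, r * dt T γ t r z =
    -(dr φ t r z * dz γ t r z - dz φ t r z * dr γ t r z)
      - (dr φ t r z * dz g t r z - dz φ t r z * dr g t r z)
      - (dr a t r z * dz γ t r z - dz a t r z * dr γ t r z)
  dt_d : ∀ t ∈ times T, ∀ r ∈ radii, ∀ z, r * dt T d t r z =
    -(dr φ t r z * dz w t r z - dz φ t r z * dr w t r z)
      - (dr a t r z * dz d t r z - dz a t r z * dr d t r z)
      + 2 * (γ t r z * dz γ t r z + dz γ t r z * g t r z + γ t r z * dz g t r z) / r ^ 3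
  inner_φ : ∀ t ∈ times T, ∀ z, φ t Real.pi z = 0
  outer_φ : ∀ t ∈ times T, ∀ z, φ t (2 * Real.pi) z = 0
  inner_a : ∀ t ∈ times T, ∀ z, a t Real.pi z = 0
  outer_a : ∀ t ∈ times T, ∀ z, a t (2 * Real.pi) z = 0

/-- The density of the kinetic energy with respect to `dr dz`. -/
noncomputable def energyDensity (p q γ : ℝ → ℝ → ℝ → ℝ) (t r z : ℝ) : ℝ :=
  r * (p t r z ^ 2 + q t r z ^ 2) / 2 + γ t r z ^ 2 / r / 2

/-- The kinetic energy in one period, divided by `2π`. -/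
noncomputable def energy (p q γ : ℝ → ℝ → ℝ → ℝ) (t : ℝ) : ℝ :=
  ∫ x in cell, energyDensity p q γ t x.1 x.2

lemma energyDensity_nonneg {p q γ : ℝ → ℝ → ℝ → ℝ} {t r z : ℝ} (hr : r ∈ radii) :
    0 ≤ energyDensity p q γ t r z := by
  have := pos_of_mem_radii hr
  unfold energyDensity; positivity

lemma energy_nonneg (p q γ : ℝ → ℝ → ℝ → ℝ) (t : ℝ) : 0 ≤ energy p q γ t :=
  setIntegral_nonneg isCompact_cell.measurableSet fun _ hx => energyDensity_nonneg hx.1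

lemma dz_eq_zero_of_forall {f : ℝ → ℝ → ℝ → ℝ} {t r : ℝ} (h : ∀ z, f t r z = 0) (z : ℝ) :
    dz f t r z = 0 := by
  have : (fun s => f t r s) = fun _ => 0 := funext h
  rw [dz, this, deriv_const]

lemma three_le_of_mem_radii {r : ℝ} (hr : r ∈ radii) : 3 ≤ r :=
  Real.pi_gt_three.le.trans hr.1

lemma le_of_mem_radii {r : ℝ} (hr : r ∈ radii) : r ≤ 8 :=
  hr.2.trans (by linarith [Real.pi_lt_four])

namespace IsPerturbation

variable {T : EReal} {φ γ a g w d p q : ℝ → ℝ → ℝ → ℝ} {t r z b : ℝ}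

lemma dz_p (h : IsPerturbation T φ γ a g w d p q) (ht : t ∈ times T) (hr : r ∈ radii) (z : ℝ) :
    dz p t r z = dr q t r z + q t r z / r := by
  have h1 : dz (dr φ) t r z = r * dz p t r z := by
    have e : (fun s => dr φ t r s) = fun s => r * p t r s := funext fun s => h.dr_φ t ht r hr s
    rw [dz, e]
    exact ((h.smooth_p.hasDerivAt_z ht hr z).const_mul r).deriv
  have h2 : dr (dz φ) t r z = 1 * q t r z + r * dr q t r z := by
    rw [dr, derivWithin_congr (fun s hs => h.dz_φ t ht s hs z) (h.dz_φ t ht r hr z)]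
    exact ((hasDerivWithinAt_id r radii).mul (h.smooth_q.hasDerivWithinAt_r ht hr z)).derivWithin
      (uniqueDiffOn_radii r hr)
  have h3 := h.smooth_φ.dr_dz ht hr z
  have := ne_zero_of_mem_radii hr
  field_simp
  linarith

/-- The time derivative of the elliptic relation. It turns the kinetic term into `r (p ∂_t p + q ∂_t
q) = ∂_r (φ ∂_t p) + ∂_z (φ ∂_t q) + r φ ∂_t d`, into which the vorticity equation can be inserted.
-/
lemma dr_dt_p_add_dz_dt_q (h : IsPerturbation T φ γ a g w d p q) (ht : t ∈ times T)
    (hr : r ∈ radii) (z : ℝ) :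
    dr (dt T p) t r z + dz (dt T q) t r z = -(r * dt T d t r z) := by
  rw [h.smooth_p.dr_dt ht hr, h.smooth_q.dz_dt ht hr]
  have h1 := (h.smooth_p.dr.hasDerivWithinAt_t ht hr z).add
    (h.smooth_q.dz.hasDerivWithinAt_t ht hr z)
  have h2 := (((h.smooth_d.hasDerivWithinAt_t ht hr z).const_mul r).neg).congr_of_mem
    (f₁ := fun s => dr p s r z + dz q s r z) (fun s hs => h.elliptic s hs r hr z) ht
  exact (uniqueDiffOn_times t ht).eq_deriv _ h1 h2

/-- The flux of energy in the radial direction. -/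
noncomputable def fluxR (T : EReal) (φ γ a w d p q : ℝ → ℝ → ℝ → ℝ) (t r z : ℝ) : ℝ :=
  φ t r z * dt T p t r z + φ t r z * (r * q t r z) * w t r z + φ t r z * dz a t r z * d t r z
    - dr a t r z * (p t r z * q t r z) + dz a t r z * (p t r z ^ 2 - q t r z ^ 2) / 2
    + (r * q t r z + dz a t r z) * γ t r z ^ 2 / r ^ 2 / 2

/-- The flux of energy in the vertical direction. -/
noncomputable def fluxZ (T : EReal) (φ γ a g w d p q : ℝ → ℝ → ℝ → ℝ) (t r z : ℝ) : ℝ :=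
  φ t r z * dt T q t r z - φ t r z * (r * p t r z) * w t r z - φ t r z * dr a t r z * d t r z
    + dz a t r z * (p t r z * q t r z) + dr a t r z * (p t r z ^ 2 - q t r z ^ 2) / 2
    + φ t r z * (γ t r z ^ 2 + 2 * (γ t r z * g t r z)) / r ^ 3
    - (r * p t r z + dr a t r z) * γ t r z ^ 2 / r ^ 2 / 2

/-- The production of energy, a quadratic form in `(p, q, γ)`. -/
noncomputable def production (γ a g p q : ℝ → ℝ → ℝ → ℝ) (t r z : ℝ) : ℝ :=
  (dr (dr a) t r z - dz (dz a) t r z - dr a t r z / r) * (p t r z * q t r z)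
    - dz (dr a) t r z * (p t r z ^ 2 - q t r z ^ 2) - dz a t r z / r * q t r z ^ 2
    + dz a t r z / r ^ 3 * γ t r z ^ 2 - dz g t r z / r * (γ t r z * p t r z)
    + (dr g t r z / r - 2 * g t r z / r ^ 2) * (γ t r z * q t r z)

lemma smooth_energyDensity (h : IsPerturbation T φ γ a g w d p q) :
    SmoothEvolution T (energyDensity p q γ) :=
  ((SmoothEvolution.radius.mul ((h.smooth_p.pow 2).add (h.smooth_q.pow 2))).div
    (SmoothEvolution.const 2) (by simp)).add ((h.smooth_γ.pow 2).div_radius.div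
      (SmoothEvolution.const 2) (by simp))

lemma smooth_fluxR (h : IsPerturbation T φ γ a g w d p q) :
    SmoothEvolution T (fluxR T φ γ a w d p q) := by
  have hp := h.smooth_p; have hq := h.smooth_q; have hφ := h.smooth_φ
  have har := h.smooth_a.dr; have haz := h.smooth_a.dz
  have hr : SmoothEvolution T (fun _ r _ => r) := SmoothEvolution.radius
  have h2 : SmoothEvolution T (fun _ _ _ => 2) := SmoothEvolution.const 2
  exact (((((hφ.mul hp.dt).add ((hφ.mul (hr.mul hq)).mul h.smooth_w)).add
    ((hφ.mul haz).mul h.smooth_d)).sub (har.mul (hp.mul hq))).add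
    ((haz.mul ((hp.pow 2).sub (hq.pow 2))).div h2 (by simp))).add
    (((((hr.mul hq).add haz).mul (h.smooth_γ.pow 2)).div_radius_pow 2).div h2 (by simp))

lemma smooth_fluxZ (h : IsPerturbation T φ γ a g w d p q) :
    SmoothEvolution T (fluxZ T φ γ a g w d p q) := by
  have hp := h.smooth_p; have hq := h.smooth_q; have hφ := h.smooth_φ; have hγ := h.smooth_γ
  have har := h.smooth_a.dr; have haz := h.smooth_a.dz
  have hr : SmoothEvolution T (fun _ r _ => r) := SmoothEvolution.radius
  have h2 : SmoothEvolution T (fun _ _ _ => 2) := SmoothEvolution.const 2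
  exact ((((((hφ.mul hq.dt).sub ((hφ.mul (hr.mul hp)).mul h.smooth_w)).sub
    ((hφ.mul har).mul h.smooth_d)).add (haz.mul (hp.mul hq))).add
    ((har.mul ((hp.pow 2).sub (hq.pow 2))).div h2 (by simp))).add
    ((hφ.mul ((hγ.pow 2).add (h2.mul (hγ.mul h.smooth_g)))).div_radius_pow 3)).sub
    (((((hr.mul hp).add har).mul (hγ.pow 2)).div_radius_pow 2).div h2 (by simp))

/-- The local balance of energy. -/
lemma dt_energyDensity (h : IsPerturbation T φ γ a g w d p q) (ht : t ∈ times T)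
    (hr : r ∈ radii) (z : ℝ) :
    dt T (energyDensity p q γ) t r z = dr (fluxR T φ γ a w d p q) t r z
      + dz (fluxZ T φ γ a g w d p q) t r z + production γ a g p q t r z := by
  have hr0 := ne_zero_of_mem_radii hr
  have ur := uniqueDiffOn_radii r hr
  have idr := hasDerivWithinAt_id r radii
  have h1 : dt T (energyDensity p q γ) t r z =
      r * (p t r z * dt T p t r z + q t r z * dt T q t r z) + γ t r z * dt T γ t r z / r := by
    have e0 := ((((h.smooth_p.hasDerivWithinAt_t ht hr z).pow 2).add
      ((h.smooth_q.hasDerivWithinAt_t ht hr z).pow 2)).const_mul r).div_const 2 |>.add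
      ((((h.smooth_γ.hasDerivWithinAt_t ht hr z).pow 2).div_const r).div_const 2)
    have e1 : dt T (energyDensity p q γ) t r z = _ := e0.derivWithin (uniqueDiffOn_times t ht)
    rw [e1]
    push_cast
    ring
  have pr := h.smooth_p.hasDerivWithinAt_r ht hr z
  have qr := h.smooth_q.hasDerivWithinAt_r ht hr z
  have φr := h.smooth_φ.hasDerivWithinAt_r ht hr z
  have γr := h.smooth_γ.hasDerivWithinAt_r ht hr z
  have wr := h.smooth_w.hasDerivWithinAt_r ht hr z
  have ddr := h.smooth_d.hasDerivWithinAt_r ht hr z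
  have ptr := h.smooth_p.dt.hasDerivWithinAt_r ht hr z
  have arr := h.smooth_a.dr.hasDerivWithinAt_r ht hr z
  have azr := h.smooth_a.dz.hasDerivWithinAt_r ht hr z
  have pz := h.smooth_p.hasDerivAt_z ht hr z
  have qz := h.smooth_q.hasDerivAt_z ht hr z
  have φz := h.smooth_φ.hasDerivAt_z ht hr z
  have γz := h.smooth_γ.hasDerivAt_z ht hr z
  have gz := h.smooth_g.hasDerivAt_z ht hr z
  have wz := h.smooth_w.hasDerivAt_z ht hr z
  have ddz := h.smooth_d.hasDerivAt_z ht hr z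
  have qtz := h.smooth_q.dt.hasDerivAt_z ht hr z
  have arz := h.smooth_a.dr.hasDerivAt_z ht hr z
  have azz := h.smooth_a.dz.hasDerivAt_z ht hr z
  have e1 := (((((φr.mul ptr).add ((φr.mul (idr.mul qr)).mul wr)).add
    ((φr.mul azr).mul ddr)).sub (arr.mul (pr.mul qr))).add
    ((azr.mul ((pr.pow 2).sub (qr.pow 2))).div_const 2)).add
    (((((idr.mul qr).add azr).mul (γr.pow 2)).div (idr.pow 2) (pow_ne_zero 2 hr0)).div_const 2)
  have e2 := ((((((φz.mul qtz).sub ((φz.mul (pz.const_mul r)).mul wz)).sub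
    ((φz.mul arz).mul ddz)).add (azz.mul (pz.mul qz))).add
    ((arz.mul ((pz.pow 2).sub (qz.pow 2))).div_const 2)).add
    ((φz.mul ((γz.pow 2).add ((γz.mul gz).const_mul 2))).div_const (r ^ 3))).sub
    (((((pz.const_mul r).add arz).mul (γz.pow 2)).div_const (r ^ 2)).div_const 2)
  have f1 : dr (fluxR T φ γ a w d p q) t r z = _ := e1.derivWithin ur
  have f2 : dz (fluxZ T φ γ a g w d p q) t r z = _ := e2.deriv
  rw [f1, f2, h1]
  -- The relations `k1`–`k8` eliminate the gradient of `φ`, `∂_z p`, `∂_r p`, `∂_r ∂_t p`, one mixed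
  -- derivative of `a`, and the time derivatives of `γ` and `d`. What remains is a rational identity
  -- in independent quantities.
  have k1 := h.dr_φ t ht r hr z
  have k2 := h.dz_φ t ht r hr z
  have k3 := h.dz_p ht hr z
  have k4 : dr p t r z = -(r * d t r z) - dz q t r z := by linarith [h.elliptic t ht r hr z]
  have k5 : dr (dt T p) t r z = -(r * dt T d t r z) - dz (dt T q) t r z := by
    linarith [h.dr_dt_p_add_dz_dt_q ht hr z]
  have k6 := h.smooth_a.dr_dz ht hr z
  have k7 := h.dt_γ t ht r hr z
  have k8 := h.dt_d t ht r hr z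
  rw [k1, k2, mul_comm, ← eq_div_iff hr0] at k7 k8
  simp only [Pi.mul_apply, Pi.add_apply, Pi.sub_apply, Pi.pow_apply, id, production]
  rw [k5, k6, k4, k3, k1, k2, k7, k8]
  push_cast
  field_simp
  ring

/-- When `φ` and `a` vanish for all `z`, so do their tangential derivatives, hence `q` and `∂_z a`;
every term of the flux contains one of these or `φ`. -/
lemma fluxR_eq_zero (h : IsPerturbation T φ γ a g w d p q) (ht : t ∈ times T) (hr : r ∈ radii)
    (hφ : ∀ z, φ t r z = 0) (ha : ∀ z, a t r z = 0) (z : ℝ) :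
    fluxR T φ γ a w d p q t r z = 0 := by
  have hq : q t r z = 0 := by
    have := h.dz_φ t ht r hr z
    rw [dz_eq_zero_of_forall hφ] at this
    simpa [ne_zero_of_mem_radii hr] using this.symm
  simp [fluxR, hφ, hq, dz_eq_zero_of_forall ha]

/-- Each product is at most half the sum of the squares, so the form is at most `5M (p² + q² + γ²)`.
Because `3 ≤ r ≤ 8`, the energy density is at least `(p² + q² + γ²)/16`, whence `80 = 5 · 16`. -/
lemma abs_production_le {M : ℝ} (hr : r ∈ radii)
    (h₁ : |dr (dr a) t r z - dz (dz a) t r z - dr a t r z / r| ≤ M)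
    (h₂ : |dz (dr a) t r z| ≤ M) (h₃ : |dz a t r z / r| ≤ M) (h₄ : |dz a t r z / r ^ 3| ≤ M)
    (h₅ : |dz g t r z / r| ≤ M) (h₆ : |dr g t r z / r - 2 * g t r z / r ^ 2| ≤ M) :
    |production γ a g p q t r z| ≤ 80 * M * energyDensity p q γ t r z := by
  have hM : 0 ≤ M := (abs_nonneg _).trans h₁
  have key (c x y : ℝ) (hc : |c| ≤ M) : |c * (x * y)| ≤ M * (x ^ 2 + y ^ 2) / 2 := by
    rw [abs_mul, abs_mul]
    have : |x| * |y| ≤ (x ^ 2 + y ^ 2) / 2 := by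
      nlinarith [sq_nonneg (|x| - |y|), sq_abs x, sq_abs y]
    calc |c| * (|x| * |y|) ≤ M * ((x ^ 2 + y ^ 2) / 2) := by gcongr
      _ = _ := by ring
  have e : 5 * M * (p t r z ^ 2 + q t r z ^ 2 + γ t r z ^ 2) ≤
      80 * M * energyDensity p q γ t r z := by
    have r3 := three_le_of_mem_radii hr
    have r8 := le_of_mem_radii hr
    have hp : (p t r z ^ 2 + q t r z ^ 2) / 16 ≤ r * (p t r z ^ 2 + q t r z ^ 2) / 2 := by
      nlinarith [sq_nonneg (p t r z), sq_nonneg (q t r z)]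
    have hg : γ t r z ^ 2 / 16 ≤ γ t r z ^ 2 / r / 2 := by
      have : γ t r z ^ 2 / 8 ≤ γ t r z ^ 2 / r := by gcongr
      linarith
    have : (p t r z ^ 2 + q t r z ^ 2 + γ t r z ^ 2) / 16 ≤ energyDensity p q γ t r z := by
      unfold energyDensity; linarith
    calc _ = 80 * M * ((p t r z ^ 2 + q t r z ^ 2 + γ t r z ^ 2) / 16) := by ring
      _ ≤ _ := by gcongr
  refine le_trans ?_ e
  have a1 := abs_le.1 (key _ (p t r z) (q t r z) h₁)
  have a2 := abs_le.1 (key _ (p t r z) (p t r z) h₂)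
  have a3 := abs_le.1 (key _ (q t r z) (q t r z) h₂)
  have a4 := abs_le.1 (key _ (q t r z) (q t r z) h₃)
  have a5 := abs_le.1 (key _ (γ t r z) (γ t r z) h₄)
  have a6 := abs_le.1 (key _ (γ t r z) (p t r z) h₅)
  have a7 := abs_le.1 (key _ (γ t r z) (q t r z) h₆)
  have n1 := mul_nonneg hM (sq_nonneg (p t r z))
  have n2 := mul_nonneg hM (sq_nonneg (q t r z))
  have n3 := mul_nonneg hM (sq_nonneg (γ t r z))
  rw [production, abs_le]
  constructor <;> nlinarith

/-- Integrating the local balance over one period removes the radial flux by the wall conditions and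
the vertical one by periodicity; Gronwall handles the production. -/
lemma energy_le (h : IsPerturbation T φ γ a g w d p q) (hb : b ∈ times T) {M : ℝ}
    (hM : ∀ t ∈ Icc 0 b, ∀ r ∈ radii, ∀ z ∈ Icc (-Real.pi) Real.pi,
      |production γ a g p q t r z| ≤ M * energyDensity p q γ t r z) :
    energy p q γ b ≤ energy p q γ 0 * Real.exp (M * b) := by
  have hb0 : (0 : ℝ) ≤ b := hb.1
  have hbound : ∀ s ∈ Icc 0 b, |∫ x in cell, dt T (energyDensity p q γ) s x.1 x.2| ≤
      M * |energy p q γ s| := by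
    intro s hs
    have hs' := Icc_subset_times hb hs
    have i1 := h.smooth_fluxR.dr.integrableOn hs' isCompact_cell cell_subset
    have i2 := h.smooth_fluxZ.dz.integrableOn hs' isCompact_cell cell_subset
    have i0 := h.smooth_energyDensity.dt.integrableOn hs' isCompact_cell cell_subset
    have ie := h.smooth_energyDensity.integrableOn hs' isCompact_cell cell_subset
    have z1 : ∫ x in cell, dr (fluxR T φ γ a w d p q) s x.1 x.2 = 0 :=
      h.smooth_fluxR.integral_cell_dr hs'
        (h.fluxR_eq_zero hs' pi_mem_radii (h.inner_φ s hs') (h.inner_a s hs'))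
        (h.fluxR_eq_zero hs' two_pi_mem_radii (h.outer_φ s hs') (h.outer_a s hs'))
    have z2 := h.smooth_fluxZ.integral_cell_dz hs'
    -- Subtracting the flux derivatives costs nothing, since their integrals vanish, and leaves the
    -- production pointwise.
    have e : ∫ x in cell, dt T (energyDensity p q γ) s x.1 x.2 =
        ∫ x in cell, (dt T (energyDensity p q γ) s x.1 x.2 - dr (fluxR T φ γ a w d p q) s x.1 x.2
          - dz (fluxZ T φ γ a g w d p q) s x.1 x.2) := by
      have i3 := (h.smooth_energyDensity.dt.sub h.smooth_fluxR.dr).integrableOn hs' isCompact_cell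
        cell_subset
      rw [integral_sub i3 i2, integral_sub i0 i1, z1, z2]; ring
    rw [e, abs_of_nonneg (energy_nonneg p q γ s), energy, ← integral_const_mul]
    rw [← Real.norm_eq_abs]
    refine norm_integral_le_of_norm_le (ie.const_mul M)
      ((ae_restrict_mem isCompact_cell.measurableSet).mono fun x hx => ?_)
    rw [h.dt_energyDensity hs' hx.1, Real.norm_eq_abs]
    convert hM s hs x.1 hx.1 x.2 hx.2 using 2
    ring
  have := abs_le_of_abs_deriv_le (fun s hs =>
    h.smooth_energyDensity.hasDerivWithinAt_integral isCompact_cell cell_subset hb hs)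
    hbound b ⟨hb0, le_rfl⟩
  change |energy p q γ b| ≤ |energy p q γ 0| * _ at this
  rwa [abs_of_nonneg (energy_nonneg p q γ _), abs_of_nonneg (energy_nonneg p q γ _)] at this

/-- The coefficients of the form are continuous and hence bounded on a compact time interval. The
bound depends on the background solution, which is harmless where the initial energy is zero. -/
lemma exists_production_le (h : IsPerturbation T φ γ a g w d p q) (hb : b ∈ times T) :
    ∃ M, ∀ t ∈ Icc 0 b, ∀ r ∈ radii, ∀ z ∈ Icc (-Real.pi) Real.pi,
      |production γ a g p q t r z| ≤ M * energyDensity p q γ t r z := by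
  have ha := h.smooth_a; have hg := h.smooth_g
  obtain ⟨M₁, n₁, h₁⟩ := ((ha.dr.dr.sub ha.dz.dz).sub ha.dr.div_radius).exists_bound hb
    (-Real.pi) Real.pi
  obtain ⟨M₂, n₂, h₂⟩ := ha.dr.dz.exists_bound hb (-Real.pi) Real.pi
  obtain ⟨M₃, n₃, h₃⟩ := ha.dz.div_radius.exists_bound hb (-Real.pi) Real.pi
  obtain ⟨M₄, n₄, h₄⟩ := (ha.dz.div_radius_pow 3).exists_bound hb (-Real.pi) Real.pi
  obtain ⟨M₅, n₅, h₅⟩ := hg.dz.div_radius.exists_bound hb (-Real.pi) Real.pi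
  obtain ⟨M₆, n₆, h₆⟩ := (hg.dr.div_radius.sub
    (((SmoothEvolution.const 2).mul hg).div_radius_pow 2)).exists_bound hb (-Real.pi) Real.pi
  refine ⟨80 * (M₁ + M₂ + M₃ + M₄ + M₅ + M₆), fun t ht r hr z hz => ?_⟩
  refine abs_production_le hr ((h₁ t ht r hr z hz).trans ?_) ((h₂ t ht r hr z hz).trans ?_)
    ((h₃ t ht r hr z hz).trans ?_) ((h₄ t ht r hr z hz).trans ?_) ((h₅ t ht r hr z hz).trans ?_)
    ((h₆ t ht r hr z hz).trans ?_) <;> linarith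

end IsPerturbation

end

/-! ### Elliptic estimate, differences of solutions, and the odd symmetry of the stream function. -/

section

namespace IsPerturbation

variable {T : EReal} {φ γ a g w d p q : ℝ → ℝ → ℝ → ℝ} {t r z b : ℝ}

/-- The elliptic estimate: the energy is bounded by the vorticity and the angular momentum. -/
lemma energy_le_data (h : IsPerturbation T φ γ a g w d p q) (ht : t ∈ times T) :
    energy p q γ t ≤
      ∫ x in cell, (256 * (x.1 * d t x.1 x.2) ^ 2 + γ t x.1 x.2 ^ 2 / x.1 / 2) := by
  have hrad : SmoothEvolution T (fun _ r _ => r) := SmoothEvolution.radius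
  have s1 := h.smooth_φ.mul h.smooth_p
  have s2 := h.smooth_φ.mul h.smooth_q
  have s3 := (hrad.sub (SmoothEvolution.const Real.pi)).mul (h.smooth_φ.pow 2)
  have s4 : SmoothEvolution T (fun t r z => 256 * (r * d t r z) ^ 2 + γ t r z ^ 2 / r / 2) :=
    ((SmoothEvolution.const 256).mul ((hrad.mul h.smooth_d).pow 2)).add
      ((h.smooth_γ.pow 2).div_radius.div (SmoothEvolution.const 2) (by simp))
  have z1 := s1.integral_cell_dr ht (by simp [h.inner_φ t ht]) (by simp [h.outer_φ t ht])
  have z2 := s2.integral_cell_dz ht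
  have z3 := s3.integral_cell_dr ht (by simp) (by simp [h.outer_φ t ht])
  have i1 := s1.dr.integrableOn ht isCompact_cell cell_subset
  have i2 := s2.dz.integrableOn ht isCompact_cell cell_subset
  have i3 := s3.dr.integrableOn ht isCompact_cell cell_subset
  have i4 := s4.integrableOn ht isCompact_cell cell_subset
  have i5 := h.smooth_energyDensity.integrableOn ht isCompact_cell cell_subset
  have i12 := (s1.dr.add s2.dz).integrableOn ht isCompact_cell cell_subset
  have i123 := ((s1.dr.add s2.dz).add (s3.dr.div (SmoothEvolution.const 512) (by simp))).integrableOn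
    ht isCompact_cell cell_subset
  have i1234 := (((s1.dr.add s2.dz).add (s3.dr.div (SmoothEvolution.const 512) (by simp))).add
    s4).integrableOn ht isCompact_cell cell_subset
  -- The three derivative terms integrate to zero. The first two produce `r (p² + q²) - r φ d`; the
  -- third is a Poincaré inequality in disguise, with the weight `r - π`. Its cross term is absorbed
  -- using `(r - π)² r ≤ 128`, leaving `φ²/1024` at the cost of `r p²/2`, and `φ²/1024 - φ (r d) +
  -- 256 (r d)²` is the square in `n2`.
  have key : energy p q γ t ≤ ∫ x in cell,
      (dr (fun t r z => φ t r z * p t r z) t x.1 x.2 + dz (fun t r z => φ t r z * q t r z) t x.1 x.2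
        + dr (fun t r z => (r - Real.pi) * φ t r z ^ 2) t x.1 x.2 / 512
        + (256 * (x.1 * d t x.1 x.2) ^ 2 + γ t x.1 x.2 ^ 2 / x.1 / 2)) := by
    refine setIntegral_mono_on i5 i1234 isCompact_cell.measurableSet fun x hx => ?_
    obtain ⟨r, z⟩ := x
    have hr : r ∈ radii := hx.1
    have d1 : dr (fun t r z => φ t r z * p t r z) t r z = _ :=
      ((h.smooth_φ.hasDerivWithinAt_r ht hr z).mul
      (h.smooth_p.hasDerivWithinAt_r ht hr z)).derivWithin (uniqueDiffOn_radii r hr)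
    have d2 : dz (fun t r z => φ t r z * q t r z) t r z = _ :=
      ((h.smooth_φ.hasDerivAt_z ht hr z).mul (h.smooth_q.hasDerivAt_z ht hr z)).deriv
    have d3 : dr (fun t r z => (r - Real.pi) * φ t r z ^ 2) t r z = _ :=
      (((hasDerivWithinAt_id r radii).sub_const Real.pi).mul
      ((h.smooth_φ.hasDerivWithinAt_r ht hr z).pow 2)).derivWithin (uniqueDiffOn_radii r hr)
    simp only [d1, d2, d3, h.dr_φ t ht r hr, h.dz_φ t ht r hr, energyDensity]
    have e := h.elliptic t ht r hr z
    have e' : dr p t r z = -(r * d t r z) - dz q t r z := by linarith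
    rw [e']
    have r3 := three_le_of_mem_radii hr
    have r8 := le_of_mem_radii hr
    have hrp : (r - Real.pi) ^ 2 ≤ 16 := by
      have := hr.1; have := hr.2; have := Real.pi_lt_four
      nlinarith
    have hrp2 : (r - Real.pi) ^ 2 * r ^ 2 * p t r z ^ 2 ≤ 128 * (r * p t r z ^ 2) := by
      have : (r - Real.pi) ^ 2 * r ≤ 16 * 8 := by gcongr
      calc _ = (r - Real.pi) ^ 2 * r * (r * p t r z ^ 2) := by ring
        _ ≤ 16 * 8 * (r * p t r z ^ 2) := by gcongr
        _ = _ := by ring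
    have n1 := sq_nonneg (φ t r z + 2 * (r - Real.pi) * (r * p t r z))
    have n2 := sq_nonneg (φ t r z / 32 - 16 * (r * d t r z))
    simp only [Pi.pow_apply, id]
    push_cast
    nlinarith
  refine key.trans (le_of_eq ?_)
  rw [integral_add i123 i4, integral_add i12 (i3.div_const 512), integral_add i1 i2, z1, z2,
    integral_div, z3]
  ring

end IsPerturbation

namespace IsSmoothSolution

variable {T : EReal} {u₀ ω₀ u₀' ω₀' : ℝ → ℝ → ℝ} {uθ ωθ ψ uθ' ωθ' ψ' : ℝ → ℝ → ℝ → ℝ}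
  {t r z b : ℝ}

lemma smooth_Γ (h : IsSmoothSolution T u₀ ω₀ uθ ωθ ψ) :
    SmoothEvolution T (fun t r z => r * uθ t r z) :=
  SmoothEvolution.radius.mul h.smooth_uθ

lemma smooth_w (h : IsSmoothSolution T u₀ ω₀ uθ ωθ ψ) :
    SmoothEvolution T (fun t r z => ωθ t r z / r) := h.smooth_ωθ.div_radius

lemma smooth_uz (h : IsSmoothSolution T u₀ ω₀ uθ ωθ ψ) : SmoothEvolution T (uz ψ) :=
  ((SmoothEvolution.const 1).div_radius).mul h.smooth_ψ.dr

lemma smooth_ur (h : IsSmoothSolution T u₀ ω₀ uθ ωθ ψ) : SmoothEvolution T (ur ψ) :=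
  ((SmoothEvolution.const 1).div_radius).mul h.smooth_ψ.dz.neg

/-- Multiplying by `r` puts the transport term into Jacobian form in `ψ` and `Γ`, which is bilinear
and convenient for taking differences of solutions. -/
lemma dt_Γ (h : IsSmoothSolution T u₀ ω₀ uθ ωθ ψ) (ht : t ∈ times T) (hr : r ∈ radii) (z : ℝ) :
    r * dt T (fun t r z => r * uθ t r z) t r z =
      -(dr ψ t r z * dz (fun t r z => r * uθ t r z) t r z
        - dz ψ t r z * dr (fun t r z => r * uθ t r z) t r z) := by
  have := h.swirl t ht r hr z
  have hr0 := ne_zero_of_mem_radii hr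
  simp only [materialDeriv, ur, uz] at this
  field_simp at this
  linarith

lemma dt_w (h : IsSmoothSolution T u₀ ω₀ uθ ωθ ψ) (ht : t ∈ times T) (hr : r ∈ radii) (z : ℝ) :
    r * dt T (fun t r z => ωθ t r z / r) t r z =
      -(dr ψ t r z * dz (fun t r z => ωθ t r z / r) t r z
        - dz ψ t r z * dr (fun t r z => ωθ t r z / r) t r z)
      + 2 * ((r * uθ t r z) * dz (fun t r z => r * uθ t r z) t r z) / r ^ 3 := by
  have := h.vorticity t ht r hr z
  have hr0 := ne_zero_of_mem_radii hr
  have e : dz (fun t r z => (r * uθ t r z) ^ 2) t r z = _ :=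
    ((h.smooth_Γ.hasDerivAt_z ht hr z).pow 2).deriv
  rw [e] at this
  simp only [materialDeriv, ur, uz] at this
  generalize dz (fun t r z => ωθ t r z / r) t r z = A at *
  generalize dr (fun t r z => ωθ t r z / r) t r z = B at *
  generalize dt T (fun t r z => ωθ t r z / r) t r z = C at *
  have e2 : C = 2 * ((r * uθ t r z) * dz (fun t r z => r * uθ t r z) t r z) / r ^ 4
    - (1 / r * -dz ψ t r z * B + 1 / r * dr ψ t r z * A) := by
    push_cast at this
    simp only [pow_one] at this
    linear_combination this
  rw [e2]
  field_simp
  ring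

/-- The Biot–Savart law read as a curl; this is what makes Stokes' theorem available. -/
lemma vorticity_eq (h : IsSmoothSolution T u₀ ω₀ uθ ωθ ψ) (ht : t ∈ times T) (hr : r ∈ radii)
    (z : ℝ) : ωθ t r z = dz (ur ψ) t r z - dr (uz ψ) t r z := by
  have := h.biotSavart t ht r hr z
  have hr0 := ne_zero_of_mem_radii hr
  have e : dz (ur ψ) t r z = 1 / r * -dz (dz ψ) t r z :=
    ((h.smooth_ψ.dz.hasDerivAt_z ht hr z).neg.const_mul (1 / r)).deriv
  rw [e]
  change -(1 / r) * dr (uz ψ) t r z - _ = _ at this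
  field_simp at this ⊢
  linarith

/-- The difference of two solutions is a perturbation of the second one. -/
lemma isPerturbation (h : IsSmoothSolution T u₀ ω₀ uθ ωθ ψ)
    (h' : IsSmoothSolution T u₀' ω₀' uθ' ωθ' ψ') :
    IsPerturbation T (fun t r z => ψ t r z - ψ' t r z) (fun t r z => r * uθ t r z - r * uθ' t r z)
      ψ' (fun t r z => r * uθ' t r z) (fun t r z => ωθ t r z / r)
      (fun t r z => ωθ t r z / r - ωθ' t r z / r) (fun t r z => uz ψ t r z - uz ψ' t r z)
      (fun t r z => ur ψ' t r z - ur ψ t r z) := by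
  have tdt {f f' : ℝ → ℝ → ℝ → ℝ} (hf : SmoothEvolution T f) (hf' : SmoothEvolution T f')
      {t r : ℝ} (ht : t ∈ times T) (hr : r ∈ radii) (z : ℝ) :
      dt T (fun t r z => f t r z - f' t r z) t r z = dt T f t r z - dt T f' t r z :=
    ((hf.hasDerivWithinAt_t ht hr z).sub (hf'.hasDerivWithinAt_t ht hr z)).derivWithin
      (uniqueDiffOn_times t ht)
  have tdr {f f' : ℝ → ℝ → ℝ → ℝ} (hf : SmoothEvolution T f) (hf' : SmoothEvolution T f')
      {t r : ℝ} (ht : t ∈ times T) (hr : r ∈ radii) (z : ℝ) :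
      dr (fun t r z => f t r z - f' t r z) t r z = dr f t r z - dr f' t r z :=
    ((hf.hasDerivWithinAt_r ht hr z).sub (hf'.hasDerivWithinAt_r ht hr z)).derivWithin
      (uniqueDiffOn_radii r hr)
  have tdz {f f' : ℝ → ℝ → ℝ → ℝ} (hf : SmoothEvolution T f) (hf' : SmoothEvolution T f')
      {t r : ℝ} (ht : t ∈ times T) (hr : r ∈ radii) (z : ℝ) :
      dz (fun t r z => f t r z - f' t r z) t r z = dz f t r z - dz f' t r z :=
    ((hf.hasDerivAt_z ht hr z).sub (hf'.hasDerivAt_z ht hr z)).deriv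
  refine ⟨h.smooth_ψ.sub h'.smooth_ψ, h.smooth_Γ.sub h'.smooth_Γ, h'.smooth_ψ, h'.smooth_Γ,
    h.smooth_w, h.smooth_w.sub h'.smooth_w, h.smooth_uz.sub h'.smooth_uz,
    h'.smooth_ur.sub h.smooth_ur, ?_, ?_, ?_, ?_, ?_, ?_, ?_, h'.inner_wall, h'.outer_wall⟩
  · intro t ht r hr z
    have hr0 := ne_zero_of_mem_radii hr
    rw [tdr h.smooth_ψ h'.smooth_ψ ht hr, uz, uz]
    field_simp
  · intro t ht r hr z
    have hr0 := ne_zero_of_mem_radii hr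
    rw [tdz h.smooth_ψ h'.smooth_ψ ht hr, ur, ur]
    field_simp
    ring
  · intro t ht r hr z
    have hr0 := ne_zero_of_mem_radii hr
    rw [tdr h.smooth_uz h'.smooth_uz ht hr, tdz h'.smooth_ur h.smooth_ur ht hr,
      h.vorticity_eq ht hr, h'.vorticity_eq ht hr]
    field_simp
    ring
  -- With `J` the Jacobian, `J(ψ, Γ) - J(ψ', Γ') = J(φ, γ) + J(φ, Γ') + J(ψ', γ)`. The next item
  -- uses the shorter splitting `J(ψ, w) - J(ψ', w') = J(φ, w) + J(ψ', d)`.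
  · intro t ht r hr z
    rw [tdt h.smooth_Γ h'.smooth_Γ ht hr, tdr h.smooth_Γ h'.smooth_Γ ht hr,
      tdz h.smooth_Γ h'.smooth_Γ ht hr, tdr h.smooth_ψ h'.smooth_ψ ht hr,
      tdz h.smooth_ψ h'.smooth_ψ ht hr, mul_sub, h.dt_Γ ht hr, h'.dt_Γ ht hr]
    ring
  · intro t ht r hr z
    rw [tdt h.smooth_w h'.smooth_w ht hr, tdr h.smooth_w h'.smooth_w ht hr,
      tdz h.smooth_w h'.smooth_w ht hr, tdz h.smooth_Γ h'.smooth_Γ ht hr,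
      tdr h.smooth_ψ h'.smooth_ψ ht hr,
      tdz h.smooth_ψ h'.smooth_ψ ht hr, mul_sub, h.dt_w ht hr, h'.dt_w ht hr]
    ring
  · intro t ht z
    simp [h.inner_wall t ht, h'.inner_wall t ht]
  · intro t ht z
    simp [h.outer_wall t ht, h'.outer_wall t ht]

/-- The fluid at rest is a solution. -/
lemma rest (T : EReal) : IsSmoothSolution T (fun _ _ => 0) (fun _ _ => 0) (fun _ _ _ => 0)
    (fun _ _ _ => 0) (fun _ _ _ => 0) := by
  have h0 : SmoothEvolution T (fun _ _ _ => (0 : ℝ)) := SmoothEvolution.const 0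
  refine ⟨h0, h0, h0, ?_, ?_, ?_, ?_, ?_, ?_, ?_⟩ <;> simp [materialDeriv, dt, dr, dz, ur, uz]

lemma dz_comp_neg (f : ℝ → ℝ → ℝ → ℝ) (t r z : ℝ) :
    dz (fun t r z => f t r (-z)) t r z = -dz f t r (-z) :=
  deriv_comp_neg (fun s => f t r s) z

lemma dz_neg_fun (f : ℝ → ℝ → ℝ → ℝ) (t r z : ℝ) :
    dz (fun t r z => -f t r z) t r z = -dz f t r z :=
  deriv.fun_neg

lemma dr_neg_fun (f : ℝ → ℝ → ℝ → ℝ) (t r z : ℝ) :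
    dr (fun t r z => -f t r z) t r z = -dr f t r z :=
  derivWithin.fun_neg

lemma dt_neg_fun (f : ℝ → ℝ → ℝ → ℝ) (t r z : ℝ) :
    dt T (fun t r z => -f t r z) t r z = -dt T f t r z :=
  derivWithin.fun_neg

/-- The reflection of a solution in the plane `z = 0`. -/
lemma reflect (h : IsSmoothSolution T u₀ ω₀ uθ ωθ ψ) :
    IsSmoothSolution T (fun r z => u₀ r (-z)) (fun r z => -ω₀ r (-z))
      (fun t r z => uθ t r (-z)) (fun t r z => -ωθ t r (-z)) (fun t r z => -ψ t r (-z)) := by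
  have e1 (t r z : ℝ) : dz (fun t r z => -ψ t r (-z)) t r z = dz ψ t r (-z) := by
    rw [dz_neg_fun (fun t r z => ψ t r (-z)), dz_comp_neg, neg_neg]
  have e2 (t r z : ℝ) : dr (fun t r z => -ψ t r (-z)) t r z = -dr ψ t r (-z) :=
    dr_neg_fun (fun t r z => ψ t r (-z)) t r z
  refine ⟨h.smooth_uθ.comp_neg, h.smooth_ωθ.comp_neg.neg, h.smooth_ψ.comp_neg.neg, ?_, ?_, ?_,
    ?_, ?_, ?_, ?_⟩
  · intro t ht r hr z
    have := h.swirl t ht r hr (-z)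
    simp only [materialDeriv, ur, uz, e1, e2] at this ⊢
    rw [dz_comp_neg (fun t r z => r * uθ t r z)]
    change dt T (fun t r z => r * uθ t r z) t r (-z)
      + 1 / r * -dz ψ t r (-z) * dr (fun t r z => r * uθ t r z) t r (-z) + _ = 0
    rw [← this]
    ring
  · intro t ht r hr z
    have := h.vorticity t ht r hr (-z)
    simp only [materialDeriv, ur, uz, e1, e2, neg_div] at this ⊢
    rw [dz_neg_fun (fun t r z => ωθ t r (-z) / r), dz_comp_neg (fun t r z => ωθ t r z / r),
      dr_neg_fun (fun t r z => ωθ t r (-z) / r), dt_neg_fun (fun t r z => ωθ t r (-z) / r),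
      dz_comp_neg (fun t r z => (r * uθ t r z) ^ 2), neg_div, ← this]
    change -dt T (fun t r z => ωθ t r z / r) t r (-z)
      + 1 / r * -dz ψ t r (-z) * -dr (fun t r z => ωθ t r z / r) t r (-z) + _ = _
    ring
  · intro t ht r hr z
    have := h.biotSavart t ht r hr (-z)
    have e3 : dz (dz (fun t r z => -ψ t r (-z))) t r z = -dz (dz ψ) t r (-z) := by
      have : dz (fun t r z => -ψ t r (-z)) = fun t r z => dz ψ t r (-z) := by
        funext t r z; exact e1 t r z
      rw [this, dz_comp_neg]
    simp only [e2, e3, mul_neg, neg_div]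
    rw [dr_neg_fun (fun t r z => 1 / r * dr ψ t r (-z)), ← this]
    change -(1 / r) * -dr (fun t r z => 1 / r * dr ψ t r z) t r (-z) - _ = _
    ring
  · intro t ht z
    simp [h.inner_wall t ht]
  · intro t ht z
    simp [h.outer_wall t ht]
  · intro r hr z
    exact h.init_uθ r hr _
  · intro r hr z
    simp [h.init_ωθ r hr]

/-- A bound for the kinetic energy in terms of the initial data. -/
noncomputable def energyBound (u₀ ω₀ : ℝ → ℝ → ℝ) : ℝ :=
  ∫ x in cell, (256 * ω₀ x.1 x.2 ^ 2 + (x.1 * u₀ x.1 x.2) ^ 2 / x.1 / 2)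

lemma energyBound_nonneg (u₀ ω₀ : ℝ → ℝ → ℝ) : 0 ≤ energyBound u₀ ω₀ :=
  setIntegral_nonneg isCompact_cell.measurableSet fun x hx => by
    have := pos_of_mem_radii hx.1
    positivity

/-- The kinetic energy of the meridional motion stays bounded. -/
lemma integral_velocity_sq_le (h : IsSmoothSolution T u₀ ω₀ uθ ωθ ψ) (hb : b ∈ times T) :
    ∫ x in cell, (ur ψ b x.1 x.2 ^ 2 + uz ψ b x.1 x.2 ^ 2) ≤ energyBound u₀ ω₀ := by
  have h0 : (0 : ℝ) ∈ times T := Icc_subset_times hb ⟨le_rfl, hb.1⟩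
  have hp := h.isPerturbation (rest T)
  -- The production is linear in the background, so it vanishes over the fluid at rest and the
  -- energy does not grow.
  have h1 := hp.energy_le hb (M := 0) fun t ht r hr z hz => by
    simp [IsPerturbation.production, dr, dz]
  have h2 := hp.energy_le_data h0
  rw [zero_mul, Real.exp_zero, mul_one] at h1
  -- The weight `r/2` in the energy exceeds `1` because `r ≥ 3`.
  have h3 : ∫ x in cell, (ur ψ b x.1 x.2 ^ 2 + uz ψ b x.1 x.2 ^ 2) ≤ energy
      (fun t r z => uz ψ t r z - uz (fun _ _ _ => 0) t r z)
      (fun t r z => ur (fun _ _ _ => 0) t r z - ur ψ t r z)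
      (fun t r z => r * uθ t r z - r * 0) b := by
    refine setIntegral_mono_on (((h.smooth_ur.pow 2).add (h.smooth_uz.pow 2)).integrableOn hb
      isCompact_cell cell_subset) (hp.smooth_energyDensity.integrableOn hb
      isCompact_cell cell_subset) isCompact_cell.measurableSet fun x hx => ?_
    have r3 := three_le_of_mem_radii hx.1
    have : 0 ≤ (x.1 * uθ b x.1 x.2) ^ 2 / x.1 / 2 := by positivity
    simp only [energyDensity, uz, dr, ur, dz, derivWithin_fun_const, deriv_const, Pi.zero_apply]
    simp only [mul_zero, neg_zero, sub_zero, zero_sub, even_two, Even.neg_pow]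
    nlinarith [sq_nonneg (1 / x.1 * -deriv (fun s => ψ b x.1 s) x.2),
      sq_nonneg (1 / x.1 * derivWithin (fun s => ψ b s x.2) radii x.1)]
  refine h3.trans (h1.trans (h2.trans (le_of_eq ?_)))
  refine setIntegral_congr_fun isCompact_cell.measurableSet fun x hx => ?_
  have hr0 := ne_zero_of_mem_radii hx.1
  simp only [h.init_uθ _ hx.1, h.init_ωθ _ hx.1]
  field_simp
  ring

/-- For data even in the swirl and odd in the vorticity, `z ↦ ψ(t, r, z)` is odd. -/
lemma stream_add_reflect (h : IsSmoothSolution T u₀ ω₀ uθ ωθ ψ)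
    (heven : ∀ r ∈ radii, ∀ z, u₀ r (-z) = u₀ r z) (hodd : ∀ r ∈ radii, ∀ z, ω₀ r (-z) = -ω₀ r z)
    (hb : b ∈ times T) (hr : r ∈ radii) (hz : z ∈ Icc (-Real.pi) Real.pi) :
    ψ b r z + ψ b r (-z) = 0 := by
  have h0 : (0 : ℝ) ∈ times T := Icc_subset_times hb ⟨le_rfl, hb.1⟩
  have hp := h.isPerturbation h.reflect
  obtain ⟨M, hM⟩ := hp.exists_production_le hb
  have h1 := hp.energy_le hb hM
  have h2 := hp.energy_le_data h0
  rw [setIntegral_congr_fun (g := fun _ => 0) isCompact_cell.measurableSet (fun x hx => by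
    simp [h.init_uθ _ hx.1, h.init_ωθ _ hx.1, heven _ hx.1, hodd _ hx.1])] at h2
  simp only [integral_zero] at h2
  have h3 := le_antisymm h2 (energy_nonneg _ _ _ _)
  rw [h3, zero_mul] at h1
  have h4 := le_antisymm h1 (energy_nonneg _ _ _ _)
  -- Zero energy forces `p = 0`, so `φ = ψ + ψ(·, -z)` is constant in `r`; it vanishes on the inner
  -- wall.
  have h5 := eq_zero_of_setIntegral_eq_zero isCompact_cell cell_subset_closure_interior
    (hp.smooth_energyDensity.continuousOn_of_subset hb cell_subset)
    (fun x hx => energyDensity_nonneg hx.1) h4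
  have h6 : ∀ s ∈ radii, dr (fun t r z => ψ t r z - -ψ t r (-z)) b s z = 0 := by
    intro s hs
    have hs0 := pos_of_mem_radii hs
    rw [hp.dr_φ b hb s hs z]
    have := h5 (s, z) ⟨hs, hz⟩
    simp only [energyDensity] at this
    set P := uz ψ b s z - uz (fun t r z => -ψ t r (-z)) b s z
    set Q := ur (fun t r z => -ψ t r (-z)) b s z - ur ψ b s z
    have n1 : 0 ≤ (s * uθ b s z - s * uθ b s (-z)) ^ 2 / s / 2 := by positivity
    have n2 : 0 ≤ s * P ^ 2 := by positivity
    have n3 : 0 ≤ s * Q ^ 2 := by positivity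
    have : s * P ^ 2 = 0 := by linarith
    simpa [hs0.ne'] using this
  have h7 := hp.smooth_φ.integral_dr_line hb pi_mem_radii hr hr.1 z
  rw [intervalIntegral.integral_congr (g := fun _ => 0) (fun s hs => by
    rw [uIcc_of_le hr.1] at hs; exact h6 s ⟨hs.1, hs.2.trans hr.2⟩)] at h7
  simp only [h.inner_wall b hb, intervalIntegral.integral_zero] at h7
  linarith

lemma stream_zero_plane (h : IsSmoothSolution T u₀ ω₀ uθ ωθ ψ)
    (heven : ∀ r ∈ radii, ∀ z, u₀ r (-z) = u₀ r z) (hodd : ∀ r ∈ radii, ∀ z, ω₀ r (-z) = -ω₀ r z)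
    (hb : b ∈ times T) (hr : r ∈ radii) : ψ b r 0 = 0 := by
  have := h.stream_add_reflect heven hodd hb hr (z := 0)
    ⟨by linarith [Real.pi_pos], Real.pi_pos.le⟩
  simp only [neg_zero] at this
  linarith

lemma stream_pi_plane (h : IsSmoothSolution T u₀ ω₀ uθ ωθ ψ)
    (heven : ∀ r ∈ radii, ∀ z, u₀ r (-z) = u₀ r z) (hodd : ∀ r ∈ radii, ∀ z, ω₀ r (-z) = -ω₀ r z)
    (hb : b ∈ times T) (hr : r ∈ radii) : ψ b r Real.pi = 0 := by
  have h1 := h.stream_add_reflect heven hodd hb hr (z := Real.pi)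
    ⟨by linarith [Real.pi_pos], le_rfl⟩
  have h2 := h.smooth_ψ.periodic b hb r hr (-Real.pi)
  rw [show -Real.pi + 2 * Real.pi = Real.pi by ring] at h2
  linarith

end IsSmoothSolution

end

section

namespace IsSmoothSolution

variable {T : EReal} {u₀ ω₀ : ℝ → ℝ → ℝ} {uθ ωθ ψ : ℝ → ℝ → ℝ → ℝ} {t r z b : ℝ}

/-! ### Transport along a horizontal plane that is invariant under the flow -/

lemma ur_inner_wall (h : IsSmoothSolution T u₀ ω₀ uθ ωθ ψ) (ht : t ∈ times T) (z : ℝ) :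
    ur ψ t Real.pi z = 0 := by
  rw [ur, dz_eq_zero_of_forall (h.inner_wall t ht)]; simp

lemma ur_outer_wall (h : IsSmoothSolution T u₀ ω₀ uθ ωθ ψ) (ht : t ∈ times T) (z : ℝ) :
    ur ψ t (2 * Real.pi) z = 0 := by
  rw [ur, dz_eq_zero_of_forall (h.outer_wall t ht)]; simp

lemma dr_eq_zero_of_forall {f : ℝ → ℝ → ℝ → ℝ} {t z : ℝ} (h : ∀ r ∈ radii, f t r z = 0)
    (hr : r ∈ radii) : dr f t r z = 0 := by
  rw [dr, derivWithin_congr (fun s hs => h s hs) (h r hr)]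
  simp

/-- No characteristics are needed: integrating by parts in `r`, with `u^r = 0` at both walls, the
time derivative of `∫ f dr` equals `∫ (∂_r u^r) f dr`. As `f ≥ 0`, this is controlled by the
integral itself, and Gronwall applies. -/
lemma eq_zero_of_transport (h : IsSmoothSolution T u₀ ω₀ uθ ωθ ψ) {f : ℝ → ℝ → ℝ → ℝ}
    (hf : SmoothEvolution T f) (hb : b ∈ times T)
    (hft : ∀ t ∈ times T, ∀ r ∈ radii, dt T f t r z = -(ur ψ t r z * dr f t r z))
    (hf0 : ∀ t ∈ times T, ∀ r ∈ radii, 0 ≤ f t r z) (hfi : ∀ r ∈ radii, f 0 r z = 0)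
    (hr : r ∈ radii) : f b r z = 0 := by
  have hpi := Real.pi_pos
  have hset (F : ℝ → ℝ) : ∫ r in radii, F r = ∫ r in Real.pi..(2 * Real.pi), F r := by
    rw [radii, integral_Icc_eq_integral_Ioc, intervalIntegral.integral_of_le (by linarith)]
  obtain ⟨M, hM0, hM⟩ := h.smooth_ur.dr.exists_bound hb z z
  have hnn : ∀ t ∈ times T, 0 ≤ ∫ r in radii, f t r z := fun t ht =>
    setIntegral_nonneg isCompact_radii.measurableSet fun r hr => hf0 t ht r hr
  have hbound : ∀ s ∈ Icc 0 b, |∫ r in radii, dt T f s r z| ≤ M * |∫ r in radii, f s r z| := by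
    intro s hs
    have hs' := Icc_subset_times hb hs
    have hm := h.smooth_ur.mul hf
    have i1 := (hm.dr.continuousOn_r hs' z).integrableOn_compact isCompact_radii (μ := volume)
    have i2 := (hf.dt.continuousOn_r hs' z).integrableOn_compact isCompact_radii (μ := volume)
    have i3 := (hf.continuousOn_r hs' z).integrableOn_compact isCompact_radii (μ := volume)
    have z1 := hm.integral_dr_line hs' pi_mem_radii two_pi_mem_radii (by linarith) z
    rw [h.ur_inner_wall hs', h.ur_outer_wall hs', ← hset] at z1
    have e : ∫ r in radii, dt T f s r z = ∫ r in radii, (dt T f s r z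
        + dr (fun t r z => ur ψ t r z * f t r z) s r z) := by
      rw [integral_add i2 i1, z1]; simp
    rw [e, abs_of_nonneg (hnn s hs'), ← integral_const_mul, ← Real.norm_eq_abs]
    refine norm_integral_le_of_norm_le (i3.const_mul M)
      ((ae_restrict_mem isCompact_radii.measurableSet).mono fun r hr => ?_)
    have d : dr (fun t r z => ur ψ t r z * f t r z) s r z = _ :=
      ((h.smooth_ur.hasDerivWithinAt_r hs' hr z).mul
        (hf.hasDerivWithinAt_r hs' hr z)).derivWithin (uniqueDiffOn_radii r hr)
    rw [d, hft s hs' r hr, Real.norm_eq_abs]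
    have e3 : -(ur ψ s r z * dr f s r z) + (dr (ur ψ) s r z * f s r z + ur ψ s r z * dr f s r z)
      = dr (ur ψ) s r z * f s r z := by ring
    rw [e3, abs_mul, abs_of_nonneg (hf0 s hs' r hr)]
    exact mul_le_mul_of_nonneg_right (hM s hs r hr z ⟨le_rfl, le_rfl⟩) (hf0 s hs' r hr)
  have key := abs_le_of_abs_deriv_le
    (fun s hs => hf.hasDerivWithinAt_integral_line hb hs z) hbound b ⟨hb.1, le_rfl⟩
  rw [setIntegral_congr_fun (g := fun _ => 0) isCompact_radii.measurableSet
    (fun r hr => hfi r hr)] at key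
  have h0 : ∫ r in radii, f b r z = 0 := by simpa using key
  exact eq_zero_of_setIntegral_eq_zero isCompact_radii radii_subset_closure_interior
    (hf.continuousOn_r hb z) (hf0 b hb) h0 r hr

/-- A closed condition on the angular momentum that is satisfied on an invariant plane at the
initial time remains satisfied. -/
lemma angular_momentum_invariant (h : IsSmoothSolution T u₀ ω₀ uθ ωθ ψ)
    (hψ : ∀ t ∈ times T, ∀ r ∈ radii, ψ t r z = 0) {H : ℝ → ℝ} (hH : ContDiff ℝ ∞ H)
    (hH0 : ∀ x, 0 ≤ H x) (hi : ∀ r ∈ radii, H (r * u₀ r z) = 0) (hb : b ∈ times T)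
    (hr : r ∈ radii) : H (r * uθ b r z) = 0 := by
  have hΓ := h.smooth_Γ
  refine h.eq_zero_of_transport (hΓ.comp hH) hb (fun t ht r hr => ?_) (fun _ _ _ _ => hH0 _)
    (fun r hr => ?_) hr
  · have hd (x : ℝ) : HasDerivAt H (deriv H x) x :=
      (hH.differentiable (by simp) x).hasDerivAt
    have e1 : dt T (fun t r z => H (r * uθ t r z)) t r z = _ :=
      ((hd _).comp_hasDerivWithinAt t (hΓ.hasDerivWithinAt_t ht hr z)).derivWithin
        (uniqueDiffOn_times t ht)
    have e2 : dr (fun t r z => H (r * uθ t r z)) t r z = _ :=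
      ((hd _).comp_hasDerivWithinAt r (hΓ.hasDerivWithinAt_r ht hr z)).derivWithin
        (uniqueDiffOn_radii r hr)
    have e3 := h.dt_Γ ht hr z
    rw [dr_eq_zero_of_forall (hψ t ht) hr] at e3
    have hr0 := ne_zero_of_mem_radii hr
    have e4 : dt T (fun t r z => r * uθ t r z) t r z
        = -(ur ψ t r z * dr (fun t r z => r * uθ t r z) t r z) := by
      rw [ur]; field_simp; linarith
    rw [e1, e2, e4]; ring
  · rw [h.init_uθ r hr]; exact hi r hr

/-- `expNegInvGlue` is smooth, nonnegative, and zero exactly on `(-∞, 0]`, so composing it with `m -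
x²` gives an admissible `H` with zero set `x² ≥ m`. -/
lemma sq_angular_momentum_ge (h : IsSmoothSolution T u₀ ω₀ uθ ωθ ψ)
    (hψ : ∀ t ∈ times T, ∀ r ∈ radii, ψ t r z = 0) {m : ℝ}
    (hi : ∀ r ∈ radii, m ≤ (r * u₀ r z) ^ 2) (hb : b ∈ times T) (hr : r ∈ radii) :
    m ≤ (r * uθ b r z) ^ 2 := by
  have := h.angular_momentum_invariant hψ (H := fun x => expNegInvGlue (m - x ^ 2))
    (expNegInvGlue.contDiff.comp (by fun_prop)) (fun _ => expNegInvGlue.nonneg _)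
    (fun r hr => expNegInvGlue.zero_of_nonpos (by linarith [hi r hr])) hb hr
  by_contra hc
  exact (expNegInvGlue.pos_of_pos (by linarith [not_le.1 hc])).ne' this

lemma sq_angular_momentum_le (h : IsSmoothSolution T u₀ ω₀ uθ ωθ ψ)
    (hψ : ∀ t ∈ times T, ∀ r ∈ radii, ψ t r z = 0) {m : ℝ}
    (hi : ∀ r ∈ radii, (r * u₀ r z) ^ 2 ≤ m) (hb : b ∈ times T) (hr : r ∈ radii) :
    (r * uθ b r z) ^ 2 ≤ m := by
  have := h.angular_momentum_invariant hψ (H := fun x => expNegInvGlue (x ^ 2 - m))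
    (expNegInvGlue.contDiff.comp (by fun_prop)) (fun _ => expNegInvGlue.nonneg _)
    (fun r hr => expNegInvGlue.zero_of_nonpos (by linarith [hi r hr])) hb hr
  by_contra hc
  exact (expNegInvGlue.pos_of_pos (by linarith [not_le.1 hc])).ne' this

/-! ### Growth of the vorticity in the upper half of the tank -/

/-- The half period `[π, 2π] × [0, π]`. -/
noncomputable def _root_.AxiEuler.halfCell : Set (ℝ × ℝ) := radii ×ˢ Icc 0 Real.pi

lemma _root_.AxiEuler.isCompact_halfCell : IsCompact halfCell := isCompact_Icc.prod isCompact_Icc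

lemma _root_.AxiEuler.halfCell_subset : halfCell ⊆ radii ×ˢ univ :=
  prod_mono subset_rfl (subset_univ _)

/-- The equation for `ω^θ` in divergence form with respect to `dr dz`: the source `∂_z (Γ²)/r³` is a
`z`-derivative, and the mixed derivatives of `ψ` cancel. -/
lemma dt_vorticity (h : IsSmoothSolution T u₀ ω₀ uθ ωθ ψ) (ht : t ∈ times T) (hr : r ∈ radii)
    (z : ℝ) : dt T ωθ t r z = dr (fun t r z => dz ψ t r z * (ωθ t r z / r)) t r z
      + dz (fun t r z => (r * uθ t r z) ^ 2 / r ^ 3 - dr ψ t r z * (ωθ t r z / r)) t r z := by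
  have hr0 := ne_zero_of_mem_radii hr
  have e1 : dt T (fun t r z => ωθ t r z / r) t r z = dt T ωθ t r z / r :=
    ((h.smooth_ωθ.hasDerivWithinAt_t ht hr z).div_const r).derivWithin (uniqueDiffOn_times t ht)
  have e2 : dr (fun t r z => dz ψ t r z * (ωθ t r z / r)) t r z = _ :=
    ((h.smooth_ψ.dz.hasDerivWithinAt_r ht hr z).mul
      (h.smooth_w.hasDerivWithinAt_r ht hr z)).derivWithin (uniqueDiffOn_radii r hr)
  have e3 : dz (fun t r z => (r * uθ t r z) ^ 2 / r ^ 3 - dr ψ t r z * (ωθ t r z / r)) t r z = _ :=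
    ((((h.smooth_Γ.hasDerivAt_z ht hr z).pow 2).div_const (r ^ 3)).sub
      ((h.smooth_ψ.dr.hasDerivAt_z ht hr z).mul (h.smooth_w.hasDerivAt_z ht hr z))).deriv
  have e4 := h.dt_w ht hr z
  rw [e1, mul_div_cancel₀ _ hr0] at e4
  rw [e4, e2, e3, h.smooth_ψ.dr_dz ht hr]
  push_cast
  ring

/-- `ψ` is constant on every side of the half period, so its tangential derivative, the factor of
the convective flux, vanishes there. -/
lemma integral_dt_vorticity (h : IsSmoothSolution T u₀ ω₀ uθ ωθ ψ)
    (h₀ : ∀ t ∈ times T, ∀ r ∈ radii, ψ t r 0 = 0)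
    (hπ : ∀ t ∈ times T, ∀ r ∈ radii, ψ t r Real.pi = 0) (ht : t ∈ times T) :
    ∫ x in halfCell, dt T ωθ t x.1 x.2 = ∫ r in Real.pi..(2 * Real.pi),
      ((r * uθ t r Real.pi) ^ 2 / r ^ 3 - (r * uθ t r 0) ^ 2 / r ^ 3) := by
  have hpi := Real.pi_pos
  have s1 := h.smooth_ψ.dz.mul h.smooth_w
  have s2 := ((h.smooth_Γ.pow 2).div_radius_pow 3).sub (h.smooth_ψ.dr.mul h.smooth_w)
  rw [setIntegral_congr_fun isCompact_halfCell.measurableSet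
    (fun x hx => h.dt_vorticity ht hx.1 x.2),
    integral_add (s1.dr.integrableOn ht isCompact_halfCell halfCell_subset)
      (s2.dz.integrableOn ht isCompact_halfCell halfCell_subset), halfCell, radii,
    s1.integral_dr ht pi_mem_radii two_pi_mem_radii (by linarith) hpi.le,
    s2.integral_dz ht pi_mem_radii two_pi_mem_radii (by linarith) hpi.le]
  simp only [dz_eq_zero_of_forall (h.inner_wall t ht), dz_eq_zero_of_forall (h.outer_wall t ht),
    zero_mul, sub_zero, intervalIntegral.integral_zero, zero_add]
  refine intervalIntegral.integral_congr fun r hr => ?_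
  rw [uIcc_of_le (by linarith)] at hr
  have hr' : r ∈ radii := hr
  simp only [dr_eq_zero_of_forall (h₀ t ht) hr', dr_eq_zero_of_forall (hπ t ht) hr']
  ring

/-- The rate of growth of the vorticity in the upper half of the tank. -/
noncomputable def _root_.AxiEuler.growthRate (k₀ : ℝ) : ℝ :=
  Real.pi * ((15 / 16) * (Real.pi * k₀) ^ 2 / 512)

/-- On `z = 0`, `|Γ| ≤ 2π · k₀/8 = πk₀/4`, so the difference of squares is at least `(15/16)(πk₀)²`.
The factor `512 = 8³` bounds `r³`, and the outer `π` is the length of the radial interval. -/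
lemma growthRate_le (h : IsSmoothSolution T u₀ ω₀ uθ ωθ ψ)
    (h₀ : ∀ t ∈ times T, ∀ r ∈ radii, ψ t r 0 = 0)
    (hπ : ∀ t ∈ times T, ∀ r ∈ radii, ψ t r Real.pi = 0) {k₀ : ℝ} (hk₀ : 0 < k₀)
    (hpi : ∀ r ∈ radii, k₀ ≤ u₀ r Real.pi) (hzero : ∀ r ∈ radii, |u₀ r 0| ≤ (1 / 8) * k₀)
    (ht : t ∈ times T) : growthRate k₀ ≤ ∫ x in halfCell, dt T ωθ t x.1 x.2 := by
  have pp := Real.pi_pos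
  rw [h.integral_dt_vorticity h₀ hπ ht]
  have s := (h.smooth_Γ.pow 2).div_radius_pow 3
  have c : ContinuousOn (fun r => (r * uθ t r Real.pi) ^ 2 / r ^ 3 - (r * uθ t r 0) ^ 2 / r ^ 3)
    radii := (s.continuousOn_r ht Real.pi).sub (s.continuousOn_r ht 0)
  have hc : growthRate k₀ = ∫ r in Real.pi..(2 * Real.pi), (15 / 16) * (Real.pi * k₀) ^ 2 / 512 := by
    rw [intervalIntegral.integral_const, growthRate, smul_eq_mul]; ring
  rw [hc]
  refine intervalIntegral.integral_mono_on (by linarith) intervalIntegrable_const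
    (c.intervalIntegrable_of_Icc (by linarith)) fun r hr => ?_
  have hr' : r ∈ radii := hr
  have r0 := pos_of_mem_radii hr'
  have b1 := h.sq_angular_momentum_ge hπ (m := (Real.pi * k₀) ^ 2) (fun r hr => by
    have := hpi r hr
    have := hr.1
    have := (pos_of_mem_radii hr).le
    gcongr) ht hr'
  have b2 := h.sq_angular_momentum_le h₀ (m := (Real.pi * k₀) ^ 2 / 16) (fun r hr => by
    have h1 := hzero r hr
    have h2 : |r * u₀ r 0| ≤ 2 * Real.pi * (1 / 8 * k₀) := by
      rw [abs_mul, abs_of_pos (pos_of_mem_radii hr)]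
      have := hr.2
      gcongr
    have h3 := pow_le_pow_left₀ (abs_nonneg _) h2 2
    rw [sq_abs] at h3
    linarith) ht hr'
  have r8 : r ^ 3 ≤ 512 := by
    calc r ^ 3 ≤ 8 ^ 3 := by gcongr; exact le_of_mem_radii hr'
      _ = 512 := by norm_num
  rw [← sub_div]
  calc 15 / 16 * (Real.pi * k₀) ^ 2 / 512 ≤ 15 / 16 * (Real.pi * k₀) ^ 2 / r ^ 3 := by gcongr
    _ ≤ _ := by gcongr; linarith

/-- The vorticity in the upper half of the tank grows at least linearly. -/
lemma integral_vorticity_ge (h : IsSmoothSolution T u₀ ω₀ uθ ωθ ψ)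
    (heven : ∀ r ∈ radii, ∀ z, u₀ r (-z) = u₀ r z) (hodd : ∀ r ∈ radii, ∀ z, ω₀ r (-z) = -ω₀ r z)
    {k₀ : ℝ} (hk₀ : 0 < k₀)
    (hpi : ∀ r ∈ radii, k₀ ≤ u₀ r Real.pi) (hzero : ∀ r ∈ radii, |u₀ r 0| ≤ (1 / 8) * k₀)
    (hb : b ∈ times T) :
    (∫ z in (0 : ℝ)..Real.pi, ∫ r in Real.pi..(2 * Real.pi), ω₀ r z) + growthRate k₀ * b ≤
      ∫ x in halfCell, ωθ b x.1 x.2 := by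
  have pp := Real.pi_pos
  have h0 : (0 : ℝ) ∈ times T := Icc_subset_times hb ⟨le_rfl, hb.1⟩
  have e0 : ∫ x in halfCell, ωθ 0 x.1 x.2 =
      ∫ z in (0 : ℝ)..Real.pi, ∫ r in Real.pi..(2 * Real.pi), ω₀ r z := by
    rw [halfCell, radii, integral_Icc_prod_swap (by linarith) pp.le
      (h.smooth_ωθ.continuousOn_of_subset h0 halfCell_subset)]
    refine intervalIntegral.integral_congr fun z _ => intervalIntegral.integral_congr fun r hr => ?_
    rw [uIcc_of_le (by linarith)] at hr
    exact h.init_ωθ r hr z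
  have hd : ∀ s ∈ Icc 0 b, HasDerivWithinAt
      (fun s => (∫ x in halfCell, ωθ s x.1 x.2) - growthRate k₀ * s)
      ((∫ x in halfCell, dt T ωθ s x.1 x.2) - growthRate k₀ * 1) (Icc 0 b) s := fun s hs =>
    (h.smooth_ωθ.hasDerivWithinAt_integral isCompact_halfCell halfCell_subset hb hs).sub
      ((hasDerivWithinAt_id s _).const_mul _)
  have hm := monotoneOn_of_hasDerivWithinAt_nonneg (convex_Icc 0 b)
    (fun s hs => (hd s hs).continuousWithinAt)
    (fun s hs => (hd s (interior_subset hs)).mono interior_subset)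
    (fun s hs => by
      have := h.growthRate_le (fun t ht r hr => h.stream_zero_plane heven hodd ht hr)
        (fun t ht r hr => h.stream_pi_plane heven hodd ht hr) hk₀ hpi hzero
        (Icc_subset_times hb (interior_subset hs))
      linarith)
  have := hm ⟨le_rfl, hb.1⟩ ⟨hb.1, le_rfl⟩ hb.1
  simp only [mul_zero, sub_zero, e0] at this
  linarith

end IsSmoothSolution

end

section

/-! ### The measure of the tank -/

/-- The projection `(r, θ, z) ↦ (r, z)`. -/
def meridional (q : ℝ × ℝ × ℝ) : ℝ × ℝ := (q.1, q.2.2)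

lemma measurable_meridional : Measurable meridional := by unfold meridional; fun_prop

lemma volume_preimage_meridional {S : Set (ℝ × ℝ)} (hS : MeasurableSet S)
    (hSr : S ⊆ radii ×ˢ Ioc (-Real.pi) Real.pi) :
    volume (meridional ⁻¹' S ∩ (radii ×ˢ Ioc (-Real.pi) Real.pi ×ˢ Ioc (-Real.pi) Real.pi)) =
      ENNReal.ofReal (2 * Real.pi) * volume S := by
  have hm : MeasurableSet (meridional ⁻¹' S ∩
      (radii ×ˢ Ioc (-Real.pi) Real.pi ×ˢ Ioc (-Real.pi) Real.pi)) :=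
    (measurable_meridional hS).inter
      (measurableSet_Icc.prod (measurableSet_Ioc.prod measurableSet_Ioc))
  rw [Measure.volume_eq_prod, Measure.prod_apply hm, Measure.volume_eq_prod ℝ ℝ,
    Measure.prod_apply hS, ← lintegral_const_mul _ (measurable_measure_prodMk_left hS)]
  refine lintegral_congr fun r => ?_
  have : Prod.mk r ⁻¹' (meridional ⁻¹' S ∩
      (radii ×ˢ Ioc (-Real.pi) Real.pi ×ˢ Ioc (-Real.pi) Real.pi)) =
      Ioc (-Real.pi) Real.pi ×ˢ (Prod.mk r ⁻¹' S) := by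
    ext ⟨θ, z⟩
    simp only [mem_preimage, meridional, mem_inter_iff, mem_prod]
    exact ⟨fun h => ⟨h.2.2.1, h.1⟩, fun h => ⟨h.2, (hSr h.2).1, h.1, (hSr h.2).2⟩⟩
  rw [this, Measure.prod_prod, Real.volume_Ioc]
  ring_nf

/-- The projection of the volume to the meridional plane has density `2πr`, which lies between `1`
and `8 · 8`. -/
lemma tankVolume_preimage_meridional {S : Set (ℝ × ℝ)} (hS : MeasurableSet S)
    (hSr : S ⊆ radii ×ˢ Ioc (-Real.pi) Real.pi) :
    volume S ≤ tankVolume (meridional ⁻¹' S) ∧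
      tankVolume (meridional ⁻¹' S) ≤ 64 * volume S := by
  have hm := measurable_meridional hS
  have hB : MeasurableSet (radii ×ˢ Ioc (-Real.pi) Real.pi ×ˢ Ioc (-Real.pi) Real.pi) :=
    measurableSet_Icc.prod (measurableSet_Ioc.prod measurableSet_Ioc)
  have hv := volume_preimage_meridional hS hSr
  rw [tankVolume, withDensity_apply _ hm, Measure.restrict_restrict hm]
  set A := meridional ⁻¹' S ∩ (radii ×ˢ Ioc (-Real.pi) Real.pi ×ˢ Ioc (-Real.pi) Real.pi)
  constructor
  · calc volume S = 1 * volume S := (one_mul _).symm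
      _ ≤ ENNReal.ofReal (2 * Real.pi) * volume S := by
        gcongr
        rw [ENNReal.one_le_ofReal]
        linarith [Real.pi_gt_three]
      _ = ∫⁻ q in A, 1 := by rw [setLIntegral_one, hv]
      _ ≤ _ := setLIntegral_mono' (hm.inter hB) fun q hq => by
        rw [ENNReal.one_le_ofReal]
        linarith [three_le_of_mem_radii hq.2.1]
  · calc ∫⁻ q in A, ENNReal.ofReal q.1 ≤ ∫⁻ q in A, ENNReal.ofReal 8 :=
        setLIntegral_mono' (hm.inter hB) fun q hq => by
          gcongr
          exact le_of_mem_radii hq.2.1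
      _ = ENNReal.ofReal 8 * (ENNReal.ofReal (2 * Real.pi) * volume S) := by
        rw [setLIntegral_const, hv]
      _ ≤ ENNReal.ofReal 8 * (ENNReal.ofReal 8 * volume S) := by
        gcongr
        linarith [Real.pi_lt_four]
      _ = 64 * volume S := by
        rw [← mul_assoc, ← ENNReal.ofReal_mul (by norm_num)]
        norm_num

/-- Hölder's inequality on a part of the upper half of the tank. -/
lemma ofReal_integral_le_tankNorm {f : ℝ → ℝ → ℝ}
    (hf : ContinuousOn (fun x : ℝ × ℝ => f x.1 x.2) (radii ×ˢ univ))
    {S : Set (ℝ × ℝ)} (hS : MeasurableSet S) (hSh : S ⊆ halfCell) {p : ENNReal} (hp : 1 ≤ p) :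
    ENNReal.ofReal (∫ x in S, f x.1 x.2) ≤
      tankNorm p f * (64 * volume S) ^ (1 - (p⁻¹).toReal) := by
  have hSr : S ⊆ radii ×ˢ Ioc (-Real.pi) Real.pi := hSh.trans
    (prod_mono subset_rfl fun z hz => ⟨by linarith [Real.pi_pos, hz.1], hz.2⟩)
  set ν := Measure.map meridional tankVolume with hν
  set F : ℝ × ℝ → ℝ := fun x => f x.1 x.2 with hF
  have hFν : AEStronglyMeasurable F (ν.restrict S) :=
    (hf.mono (hSh.trans halfCell_subset)).aestronglyMeasurable hS
  have hle : volume.restrict S ≤ ν.restrict S := by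
    refine Measure.le_iff.2 fun s hs => ?_
    rw [Measure.restrict_apply hs, Measure.restrict_apply hs,
      Measure.map_apply measurable_meridional (hs.inter hS)]
    exact (tankVolume_preimage_meridional (hs.inter hS) (inter_subset_right.trans hSr)).1
  have hνS : ν S ≤ 64 * volume S := by
    rw [hν, Measure.map_apply measurable_meridional hS]
    exact (tankVolume_preimage_meridional hS hSr).2
  have hres : ν.restrict S =
      Measure.map meridional (tankVolume.restrict (meridional ⁻¹' S)) :=
    Measure.restrict_map measurable_meridional hS
  have h1 : ENNReal.ofReal (∫ x in S, F x) ≤ eLpNorm F 1 (volume.restrict S) := by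
    rw [eLpNorm_one_eq_lintegral_enorm]
    refine le_trans ?_ (enorm_integral_le_lintegral_enorm _)
    rw [← ofReal_norm]
    exact ENNReal.ofReal_le_ofReal (le_abs_self _)
  have h2 : eLpNorm F p (ν.restrict S) ≤ tankNorm p f := by
    have hFν' := hFν
    rw [hres] at hFν'
    rw [hres, eLpNorm_map_measure hFν' measurable_meridional.aemeasurable]
    exact eLpNorm_mono_measure _ Measure.restrict_le_self
  have he : 0 ≤ 1 - (p⁻¹).toReal := by
    have : (p⁻¹).toReal ≤ (1 : ENNReal).toReal :=
      ENNReal.toReal_mono ENNReal.one_ne_top (ENNReal.inv_le_one.2 hp)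
    simpa using this
  have h3 := eLpNorm_le_eLpNorm_mul_rpow_measure_univ hp hFν
  rw [Measure.restrict_apply_univ, ENNReal.toReal_one, one_div_one, one_div,
    ← ENNReal.toReal_inv] at h3
  calc _ ≤ eLpNorm F 1 (volume.restrict S) := h1
    _ ≤ eLpNorm F 1 (ν.restrict S) := eLpNorm_mono_measure _ hle
    _ ≤ _ := h3
    _ ≤ _ := by gcongr

/-- A continuous function on the tank is bounded everywhere by its essential bound. -/
lemma abs_le_of_ae_tankVolume {f : ℝ → ℝ → ℝ}
    (hf : ContinuousOn (fun x : ℝ × ℝ => f x.1 x.2) (radii ×ˢ univ)) {V : ℝ}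
    (h : ∀ᵐ q ∂tankVolume, |f q.1 q.2.2| ≤ V) {r z : ℝ} (hr : r ∈ radii)
    (hz : z ∈ Ioc (-Real.pi) Real.pi) : |f r z| ≤ V := by
  have pp := Real.pi_pos
  set B := radii ×ˢ Ioc (-Real.pi) Real.pi ×ˢ Ioc (-Real.pi) Real.pi with hB
  have hBm : MeasurableSet B := measurableSet_Icc.prod (measurableSet_Ioc.prod measurableSet_Ioc)
  have hI : Ioc (-Real.pi) Real.pi ⊆ closure (interior (Ioc (-Real.pi) Real.pi)) := by
    rw [interior_Ioc, closure_Ioo (by linarith)]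
    exact Ioc_subset_Icc_self
  have hBi : B ⊆ closure (interior B) := by
    rw [hB, interior_prod_eq, interior_prod_eq, closure_prod_eq, closure_prod_eq]
    exact prod_mono radii_subset_closure_interior (prod_mono hI hI)
  rw [tankVolume, ae_withDensity_iff (by fun_prop)] at h
  -- The positive part turns an almost everywhere inequality into an equality, which extends by
  -- continuity.
  have hae : (fun q : ℝ × ℝ × ℝ => max (|f q.1 q.2.2| - V) 0) =ᵐ[volume.restrict B]
      fun _ => 0 := by
    filter_upwards [h, ae_restrict_mem hBm] with q hq hqB
    have hq' := hq (by
      rw [Ne, ENNReal.ofReal_eq_zero, not_le]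
      exact pos_of_mem_radii hqB.1)
    exact max_eq_right (by linarith)
  have hc : ContinuousOn (fun q : ℝ × ℝ × ℝ => f q.1 q.2.2) B :=
    hf.comp (f := fun q : ℝ × ℝ × ℝ => (q.1, q.2.2)) (by fun_prop) fun q hq => ⟨hq.1, mem_univ _⟩
  -- The angle is immaterial; `z` is reused for it because it lies in `(-π, π]`.
  have := Measure.eqOn_of_ae_eq hae
    (ContinuousOn.sup (hc.abs.sub continuousOn_const) continuousOn_const) continuousOn_const hBi (x := (r, z, z)) ⟨hr, hz, hz⟩
  have h2 := le_max_left (|f r z| - V) 0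
  simp only at this
  linarith

/-! ### Mean value lemmas -/

/-- Some slice is no larger than the average slice. For `|u|²` on a strip, this selects a line with
small energy. -/
lemma exists_integral_left_le {F : ℝ × ℝ → ℝ} {a b c d : ℝ} (hab : a < b) (hcd : c ≤ d)
    (hF : ContinuousOn F (Icc a b ×ˢ Icc c d)) :
    ∃ x ∈ Icc a b, (b - a) * ∫ y in c..d, F (x, y) ≤ ∫ x in Icc a b ×ˢ Icc c d, F x := by
  have hi : IntegrableOn F (Icc a b ×ˢ Icc c d) :=
    hF.integrableOn_compact (isCompact_Icc.prod isCompact_Icc)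
  have hi' := hi
  rw [IntegrableOn, Measure.volume_eq_prod, ← Measure.prod_restrict] at hi'
  obtain ⟨x, hx, h⟩ := exists_le_setAverage (μ := volume) (s := Icc a b)
    (by simp [hab]) (by simp) hi'.integral_prod_left
  refine ⟨x, hx, ?_⟩
  rw [setAverage_eq, Real.volume_real_Icc_of_le hab.le, smul_eq_mul,
    ← div_eq_inv_mul, le_div_iff₀ (by linarith)] at h
  rw [Measure.volume_eq_prod, setIntegral_prod _ hi, intervalIntegral.integral_of_le hcd,
    ← integral_Icc_eq_integral_Ioc, mul_comm]
  exact h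

lemma exists_integral_right_le {F : ℝ × ℝ → ℝ} {a b c d : ℝ} (hab : a < b) (hcd : c ≤ d)
    (hF : ContinuousOn F (Icc c d ×ˢ Icc a b)) :
    ∃ x ∈ Icc a b, (b - a) * ∫ y in c..d, F (y, x) ≤ ∫ x in Icc c d ×ˢ Icc a b, F x := by
  obtain ⟨x, hx, h⟩ := exists_integral_left_le (F := fun x => F x.swap) hab hcd
    (hF.comp continuous_swap.continuousOn fun x hx => ⟨hx.2, hx.1⟩)
  refine ⟨x, hx, h.trans (le_of_eq ?_)⟩
  rw [Measure.volume_eq_prod, ← setIntegral_prod_swap]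
  simp only [Prod.swap_swap]

/-- A form of the Cauchy–Schwarz inequality. -/
lemma abs_integral_le_of_integral_sq {f : ℝ → ℝ} {c d x y η : ℝ} (hcx : c ≤ x) (hxy : x ≤ y)
    (hyd : y ≤ d) (hcd : c < d) (hη : 0 < η) (hf : ContinuousOn f (Icc c d))
    (h : (d - c) * ∫ s in c..d, f s ^ 2 ≤ η ^ 2) : |∫ s in x..y, f s| ≤ η := by
  have hl : 0 < d - c := by linarith
  have i1 : IntervalIntegrable (fun s => |f s|) volume c d :=
    hf.abs.intervalIntegrable_of_Icc hcd.le
  have i2 : IntervalIntegrable (fun s => f s ^ 2) volume c d :=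
    (hf.pow 2).intervalIntegrable_of_Icc hcd.le
  calc |∫ s in x..y, f s| ≤ ∫ s in x..y, |f s| := intervalIntegral.abs_integral_le_integral_abs hxy
    _ ≤ ∫ s in c..d, |f s| := intervalIntegral.integral_mono_interval hcx hxy hyd
        (Eventually.of_forall fun s => abs_nonneg _) i1
    -- Young's inequality, weighted so that each of the two terms contributes at most `η/2`.
    _ ≤ ∫ s in c..d, ((d - c) / (2 * η) * f s ^ 2 + η / (2 * (d - c))) := by
        refine intervalIntegral.integral_mono_on hcd.le i1
          ((i2.const_mul _).add intervalIntegrable_const) fun s _ => ?_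
        have e : (d - c) / (2 * η) * f s ^ 2 + η / (2 * (d - c)) - |f s| =
            ((d - c) * |f s| - η) ^ 2 / (2 * η * (d - c)) := by
          rw [← sq_abs (f s)]; field_simp; ring
        have : 0 ≤ ((d - c) * |f s| - η) ^ 2 / (2 * η * (d - c)) := by positivity
        linarith
    _ = (d - c) * (∫ s in c..d, f s ^ 2) / (2 * η) + η / 2 := by
        rw [intervalIntegral.integral_add (i2.const_mul _) intervalIntegrable_const,
          intervalIntegral.integral_const_mul, intervalIntegral.integral_const, smul_eq_mul]
        field_simp
    _ ≤ η ^ 2 / (2 * η) + η / 2 := by gcongr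
    _ = η := by field_simp; ring

namespace IsSmoothSolution

variable {T : EReal} {u₀ ω₀ : ℝ → ℝ → ℝ} {uθ ωθ ψ : ℝ → ℝ → ℝ → ℝ} {t r z b : ℝ}

/-! ### The circulation -/

/-- Stokes' theorem on a rectangle in the meridional plane. -/
lemma integral_vorticity_eq_circulation (h : IsSmoothSolution T u₀ ω₀ uθ ωθ ψ) (ht : t ∈ times T)
    {r₁ r₂ z₁ z₂ : ℝ} (h₁ : r₁ ∈ radii) (h₂ : r₂ ∈ radii) (hr : r₁ ≤ r₂) (hz : z₁ ≤ z₂) :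
    ∫ x in Icc r₁ r₂ ×ˢ Icc z₁ z₂, ωθ t x.1 x.2 =
      (∫ r in r₁..r₂, ur ψ t r z₂) - (∫ r in r₁..r₂, ur ψ t r z₁)
        - ((∫ z in z₁..z₂, uz ψ t r₂ z) - ∫ z in z₁..z₂, uz ψ t r₁ z) := by
  have hs : Icc r₁ r₂ ⊆ radii := Icc_subset_Icc h₁.1 h₂.2
  have hs' : Icc r₁ r₂ ×ˢ Icc z₁ z₂ ⊆ radii ×ˢ univ := prod_mono hs (subset_univ _)
  have hc : IsCompact (Icc r₁ r₂ ×ˢ Icc z₁ z₂) := isCompact_Icc.prod isCompact_Icc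
  rw [setIntegral_congr_fun hc.measurableSet (fun x hx => h.vorticity_eq ht (hs hx.1) x.2),
    integral_sub (h.smooth_ur.dz.integrableOn ht hc hs') (h.smooth_uz.dr.integrableOn ht hc hs'),
    h.smooth_ur.integral_dz ht h₁ h₂ hr hz, h.smooth_uz.integral_dr ht h₁ h₂ hr hz,
    intervalIntegral.integral_sub, intervalIntegral.integral_sub]
  · exact (h.smooth_uz.continuous_z ht h₂).intervalIntegrable _ _
  · exact (h.smooth_uz.continuous_z ht h₁).intervalIntegrable _ _
  · exact ((h.smooth_ur.continuousOn_r ht z₂).mono hs).intervalIntegrable_of_Icc hr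
  · exact ((h.smooth_ur.continuousOn_r ht z₁).mono hs).intervalIntegrable_of_Icc hr

/-- Stokes on the half period, whose four sides all have length `π`. -/
lemma integral_vorticity_le_of_abs_le (h : IsSmoothSolution T u₀ ω₀ uθ ωθ ψ) (ht : t ∈ times T)
    {V : ℝ} (hur : ∀ r ∈ radii, ∀ z ∈ Icc 0 Real.pi, |ur ψ t r z| ≤ V)
    (huz : ∀ r ∈ radii, ∀ z ∈ Icc 0 Real.pi, |uz ψ t r z| ≤ V) :
    ∫ x in halfCell, ωθ t x.1 x.2 ≤ 4 * Real.pi * V := by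
  have pp := Real.pi_pos
  have hle : Real.pi ≤ 2 * Real.pi := by linarith
  have br (z : ℝ) (hz : z ∈ Icc 0 Real.pi) :
      |∫ r in Real.pi..(2 * Real.pi), ur ψ t r z| ≤ V * Real.pi := by
    have := intervalIntegral.norm_integral_le_of_norm_le_const (a := Real.pi) (b := 2 * Real.pi)
      (f := fun r => ur ψ t r z) (C := V) fun r hr => by
        rw [uIoc_of_le hle] at hr
        exact hur r ⟨hr.1.le, hr.2⟩ z hz
    rwa [show 2 * Real.pi - Real.pi = Real.pi by ring, abs_of_pos pp] at this
  have bz (r : ℝ) (hr : r ∈ radii) : |∫ z in (0 : ℝ)..Real.pi, uz ψ t r z| ≤ V * Real.pi := by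
    have := intervalIntegral.norm_integral_le_of_norm_le_const (a := 0) (b := Real.pi)
      (f := fun z => uz ψ t r z) (C := V) fun z hz => by
        rw [uIoc_of_le pp.le] at hz
        exact huz r hr z ⟨hz.1.le, hz.2⟩
    rwa [sub_zero, abs_of_pos pp] at this
  rw [halfCell, radii, h.integral_vorticity_eq_circulation ht pi_mem_radii two_pi_mem_radii hle
    pp.le]
  have b1 := abs_le.1 (br 0 ⟨le_rfl, pp.le⟩)
  have b2 := abs_le.1 (br Real.pi ⟨pp.le, le_rfl⟩)
  have b3 := abs_le.1 (bz _ pi_mem_radii)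
  have b4 := abs_le.1 (bz _ two_pi_mem_radii)
  linarith

/-- A lower bound on the vorticity in the upper half of the tank gives one on the velocity. -/
lemma velocity_lower_bound (h : IsSmoothSolution T u₀ ω₀ uθ ωθ ψ) (ht : t ∈ times T) {m : ℝ}
    (hm : m ≤ ∫ x in halfCell, ωθ t x.1 x.2) :
    ENNReal.ofReal (m / (4 * Real.pi)) ≤ tankNorm ⊤ (velocity uθ ψ t) := by
  have pp := Real.pi_pos
  by_cases htop : tankNorm ⊤ (velocity uθ ψ t) = ⊤
  · rw [htop]; exact le_top
  have hae : ∀ᵐ q ∂tankVolume,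
      ‖velocity uθ ψ t q.1 q.2.2‖ ≤ (tankNorm ⊤ (velocity uθ ψ t)).toReal := by
    filter_upwards [ae_le_eLpNormEssSup (μ := tankVolume)
      (f := fun q : ℝ × ℝ × ℝ => velocity uθ ψ t q.1 q.2.2)] with q hq
    rw [← eLpNorm_exponent_top] at hq
    rw [← toReal_enorm]
    exact ENNReal.toReal_mono htop hq
  set V := (tankNorm ⊤ (velocity uθ ψ t)).toReal
  have hz {z : ℝ} (hz : z ∈ Icc 0 Real.pi) : z ∈ Ioc (-Real.pi) Real.pi :=
    ⟨by linarith [hz.1], hz.2⟩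
  have h1 := h.integral_vorticity_le_of_abs_le ht (V := V)
    (fun r hr z hz' => abs_le_of_ae_tankVolume (h.smooth_ur.continuousOn_slice ht)
      (hae.mono fun q hq => (PiLp.norm_apply_le (velocity uθ ψ t q.1 q.2.2) 0).trans hq) hr (hz hz'))
    (fun r hr z hz' => abs_le_of_ae_tankVolume (h.smooth_uz.continuousOn_slice ht)
      (hae.mono fun q hq => (PiLp.norm_apply_le (velocity uθ ψ t q.1 q.2.2) 2).trans hq) hr (hz hz'))
  rw [← ENNReal.ofReal_toReal htop]
  refine ENNReal.ofReal_le_ofReal ?_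
  rw [div_le_iff₀ (by positivity)]
  linarith

/-- A large part of the vorticity is contained in a thin layer along the boundary. -/
lemma exists_thin_layer (h : IsSmoothSolution T u₀ ω₀ uθ ωθ ψ) (ht : t ∈ times T) (ht0 : 0 < t)
    {B : ℝ} (hB : 0 < B) (hm : B * t ≤ ∫ x in halfCell, ωθ t x.1 x.2) :
    ∃ S ⊆ halfCell, MeasurableSet S ∧ B * t / 2 ≤ ∫ x in S, ωθ t x.1 x.2 ∧
      volume S ≤
        ENNReal.ofReal (16 * (64 * Real.pi * (energyBound u₀ ω₀ + 1) / B ^ 2) / t ^ 2) := by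
  have pp := Real.pi_pos
  have p3 := Real.pi_gt_three
  have p4 := Real.pi_lt_four
  have hE := energyBound_nonneg u₀ ω₀
  -- Chosen so that a strip of width `δ = κ/t²` has `π (E + 1) = η² δ` for `η = Bt/8`, with `E` the
  -- energy bound: this is what Cauchy–Schwarz on a side of length `π` requires. The `+ 1` keeps `δ`
  -- positive when `E = 0`.
  set κ := 64 * Real.pi * (energyBound u₀ ω₀ + 1) / B ^ 2 with hκ
  have hκ0 : 0 < κ := by positivity
  set δ := κ / t ^ 2 with hδ
  have hδ0 : 0 < δ := by positivity
  have hmeas : MeasurableSet halfCell := isCompact_halfCell.measurableSet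
  have hvol (r₁ r₂ z₁ z₂ : ℝ) (hr : r₁ ≤ r₂) : volume (Icc r₁ r₂ ×ˢ Icc z₁ z₂) =
      ENNReal.ofReal ((r₂ - r₁) * (z₂ - z₁)) := by
    rw [Measure.volume_eq_prod, Measure.prod_prod, Real.volume_Icc, Real.volume_Icc,
      ENNReal.ofReal_mul (by linarith)]
  have hvolh : volume halfCell = ENNReal.ofReal (Real.pi * Real.pi) := by
    rw [halfCell, radii, hvol _ _ _ _ (by linarith)]
    ring_nf
  rw [mul_div_assoc 16, ← hδ]
  rcases lt_or_ge (Real.pi / 2) δ with hlt | hle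
  -- Opposite strips would overlap, but then the whole half period already has area `π² ≤ 16δ`.
  · refine ⟨halfCell, subset_rfl, hmeas, by nlinarith, ?_⟩
    rw [hvolh]
    exact ENNReal.ofReal_le_ofReal (by nlinarith)
  have hsq : ContinuousOn (fun x : ℝ × ℝ => ur ψ t x.1 x.2 ^ 2 + uz ψ t x.1 x.2 ^ 2)
      (radii ×ˢ univ) := ((h.smooth_ur.pow 2).add (h.smooth_uz.pow 2)).continuousOn_slice ht
  have hsub {K : Set (ℝ × ℝ)} (hK : K ⊆ cell) :
      ∫ x in K, (ur ψ t x.1 x.2 ^ 2 + uz ψ t x.1 x.2 ^ 2) ≤ energyBound u₀ ω₀ :=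
    (setIntegral_mono_set ((hsq.mono cell_subset).integrableOn_compact isCompact_cell)
      (Eventually.of_forall fun x => by positivity) hK.eventuallyLE).trans
      (h.integral_velocity_sq_le ht)
  set η := B * t / 8 with hη
  have hη0 : 0 < η := by positivity
  have hηδ : Real.pi * (energyBound u₀ ω₀ + 1) = η ^ 2 * δ := by
    rw [hδ, hκ, hη]; field_simp; norm_num
  -- The bound is stated for all subsegments because the ends of the segment depend on the
  -- horizontal lines, chosen separately.
  have vertical (a c : ℝ) (hac : c - a = δ) (ha : Real.pi ≤ a) (hc : c ≤ 2 * Real.pi) :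
      ∃ x ∈ Icc a c, ∀ z₁ z₂, 0 ≤ z₁ → z₁ ≤ z₂ → z₂ ≤ Real.pi →
        |∫ z in z₁..z₂, uz ψ t x z| ≤ η := by
    have hK : Icc a c ×ˢ Icc 0 Real.pi ⊆ cell :=
      prod_mono (Icc_subset_Icc ha hc) (Icc_subset_Icc (by linarith) le_rfl)
    obtain ⟨x, hx, hi⟩ := exists_integral_left_le (a := a) (b := c) (by linarith) pp.le
      (hsq.mono (hK.trans cell_subset))
    have hxr : x ∈ radii := Icc_subset_Icc ha hc hx
    refine ⟨x, hx, fun z₁ z₂ h0 h12 hpi => abs_integral_le_of_integral_sq h0 h12 hpi pp hη0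
      (h.smooth_uz.continuous_z ht hxr).continuousOn ?_⟩
    have hmono : ∫ z in (0 : ℝ)..Real.pi, uz ψ t x z ^ 2 ≤
        ∫ z in (0 : ℝ)..Real.pi, (ur ψ t x z ^ 2 + uz ψ t x z ^ 2) :=
      intervalIntegral.integral_mono_on pp.le
        (((h.smooth_uz.pow 2).continuous_z ht hxr).intervalIntegrable _ _)
        ((((h.smooth_ur.pow 2).add (h.smooth_uz.pow 2)).continuous_z ht hxr).intervalIntegrable
          _ _) fun z _ => by linarith [sq_nonneg (ur ψ t x z)]
    have h3 := hi.trans (hsub hK)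
    rw [hac] at h3
    have h4 := mul_le_mul_of_nonneg_left hmono hδ0.le
    rw [sub_zero]
    refine le_of_mul_le_mul_right ?_ hδ0
    rw [← hηδ]
    nlinarith
  have horizontal (a c : ℝ) (hac : c - a = δ) (ha : 0 ≤ a) (hc : c ≤ Real.pi) :
      ∃ x ∈ Icc a c, ∀ r₁ r₂, Real.pi ≤ r₁ → r₁ ≤ r₂ → r₂ ≤ 2 * Real.pi →
        |∫ r in r₁..r₂, ur ψ t r x| ≤ η := by
    have hK : Icc Real.pi (2 * Real.pi) ×ˢ Icc a c ⊆ cell :=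
      prod_mono subset_rfl (Icc_subset_Icc (by linarith) hc)
    have hpp : Real.pi ≤ 2 * Real.pi := by linarith
    obtain ⟨x, hx, hi⟩ := exists_integral_right_le (a := a) (b := c) (by linarith) hpp
      (hsq.mono (hK.trans cell_subset))
    refine ⟨x, hx, fun r₁ r₂ h0 h12 hpi => abs_integral_le_of_integral_sq h0 h12 hpi
      (by linarith) hη0 (h.smooth_ur.continuousOn_r ht x) ?_⟩
    have hmono : ∫ r in Real.pi..(2 * Real.pi), ur ψ t r x ^ 2 ≤
        ∫ r in Real.pi..(2 * Real.pi), (ur ψ t r x ^ 2 + uz ψ t r x ^ 2) :=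
      intervalIntegral.integral_mono_on hpp
        (((h.smooth_ur.pow 2).continuousOn_r ht x).intervalIntegrable_of_Icc hpp)
        ((((h.smooth_ur.pow 2).add (h.smooth_uz.pow 2)).continuousOn_r ht x).intervalIntegrable_of_Icc
          hpp) fun r _ => by linarith [sq_nonneg (uz ψ t r x)]
    have h3 := hi.trans (hsub hK)
    rw [hac] at h3
    have h4 := mul_le_mul_of_nonneg_left hmono hδ0.le
    rw [show 2 * Real.pi - Real.pi = Real.pi by ring]
    refine le_of_mul_le_mul_right ?_ hδ0
    rw [← hηδ]
    nlinarith
  obtain ⟨r₁, hr₁, c₁⟩ := vertical Real.pi (Real.pi + δ) (by ring) le_rfl (by linarith)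
  obtain ⟨r₂, hr₂, c₂⟩ := vertical (2 * Real.pi - δ) (2 * Real.pi) (by ring) (by linarith) le_rfl
  obtain ⟨z₁, hz₁, c₃⟩ := horizontal 0 δ (by ring) le_rfl (by linarith)
  obtain ⟨z₂, hz₂, c₄⟩ := horizontal (Real.pi - δ) Real.pi (by ring) (by linarith) le_rfl
  have hr : r₁ ≤ r₂ := by linarith [hr₁.2, hr₂.1]
  have hz : z₁ ≤ z₂ := by linarith [hz₁.2, hz₂.1]
  have hr₁' : r₁ ∈ radii := ⟨hr₁.1, by linarith [hr₂.2]⟩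
  have hr₂' : r₂ ∈ radii := ⟨by linarith [hr₁.1], hr₂.2⟩
  have hRm : MeasurableSet (Icc r₁ r₂ ×ˢ Icc z₁ z₂) := measurableSet_Icc.prod measurableSet_Icc
  have hR : Icc r₁ r₂ ×ˢ Icc z₁ z₂ ⊆ halfCell :=
    prod_mono (Icc_subset_Icc hr₁.1 hr₂.2) (Icc_subset_Icc hz₁.1 hz₂.2)
  -- The circulation around the inner rectangle is at most `4η = Bt/2`, so at least `Bt/2` is left
  -- in the frame.
  refine ⟨halfCell \ (Icc r₁ r₂ ×ˢ Icc z₁ z₂), sdiff_subset, hmeas.diff hRm, ?_, ?_⟩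
  · rw [setIntegral_sdiff hRm (h.smooth_ωθ.integrableOn ht isCompact_halfCell halfCell_subset) hR,
      h.integral_vorticity_eq_circulation ht hr₁' hr₂' hr hz]
    have d₁ := abs_le.1 (c₁ z₁ z₂ hz₁.1 hz hz₂.2)
    have d₂ := abs_le.1 (c₂ z₁ z₂ hz₁.1 hz hz₂.2)
    have d₃ := abs_le.1 (c₃ r₁ r₂ hr₁.1 hr hr₂.2)
    have d₄ := abs_le.1 (c₄ r₁ r₂ hr₁.1 hr hr₂.2)
    linarith
  · rw [measure_sdiff hR hRm.nullMeasurableSet (by rw [hvol _ _ _ _ hr]; exact ENNReal.ofReal_ne_top),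
      hvolh, hvol _ _ _ _ hr, ← ENNReal.ofReal_sub _ (mul_nonneg (by linarith) (by linarith))]
    refine ENNReal.ofReal_le_ofReal ?_
    -- The frame has area at most `π² - (π - 2δ)² ≤ 4πδ ≤ 16δ`.
    have l₁ : Real.pi - 2 * δ ≤ r₂ - r₁ := by linarith [hr₁.2, hr₂.1]
    have l₂ : Real.pi - 2 * δ ≤ z₂ - z₁ := by linarith [hz₁.2, hz₂.1]
    have := mul_le_mul l₁ l₂ (by linarith) (by linarith)
    nlinarith

/-- A lower bound on the vorticity in the upper half of the tank gives one on its norms. -/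
lemma vorticity_lower_bound (h : IsSmoothSolution T u₀ ω₀ uθ ωθ ψ) (ht : t ∈ times T)
    (ht0 : 0 < t) {B C : ℝ} (hB : 0 < B) (hm : B * t ≤ ∫ x in halfCell, ωθ t x.1 x.2)
    (hC : C = 64 * (16 * (64 * Real.pi * (energyBound u₀ ω₀ + 1) / B ^ 2)) + 1)
    {p : ENNReal} (hp : 1 ≤ p) :
    ENNReal.ofReal (B / (2 * C) * t ^ (3 - 2 * (p⁻¹).toReal)) ≤ tankNorm p (ωθ t) := by
  have hE := energyBound_nonneg u₀ ω₀
  have pp := Real.pi_pos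
  have hK0 : 0 ≤ 16 * (64 * Real.pi * (energyBound u₀ ω₀ + 1) / B ^ 2) := by positivity
  have hC1 : 1 ≤ C := by rw [hC]; linarith
  have hC0 : 0 < C := by linarith
  obtain ⟨S, hSh, hS, hSi, hSv⟩ := h.exists_thin_layer ht ht0 hB hm
  have hH := ofReal_integral_le_tankNorm (h.smooth_ωθ.continuousOn_slice ht) hS hSh hp
  have hs1 : (p⁻¹).toReal ≤ 1 := by
    have : (p⁻¹).toReal ≤ (1 : ENNReal).toReal :=
      ENNReal.toReal_mono ENNReal.one_ne_top (ENNReal.inv_le_one.2 hp)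
    simpa using this
  have hs0 : 0 ≤ (p⁻¹).toReal := ENNReal.toReal_nonneg
  set s := (p⁻¹).toReal
  have he : 0 ≤ 1 - s := by linarith
  have hv : 64 * volume S ≤ ENNReal.ofReal (C / t ^ 2) := by
    calc 64 * volume S ≤ ENNReal.ofReal 64 * ENNReal.ofReal
          (16 * (64 * Real.pi * (energyBound u₀ ω₀ + 1) / B ^ 2) / t ^ 2) := by
          rw [show ENNReal.ofReal 64 = 64 by simp]
          gcongr
      _ = ENNReal.ofReal (64 * (16 * (64 * Real.pi * (energyBound u₀ ω₀ + 1) / B ^ 2)) / t ^ 2) := by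
          rw [← ENNReal.ofReal_mul (by norm_num), mul_div_assoc 64]
      _ ≤ _ := by
          gcongr
          linarith
  have hX : 0 < C / t ^ 2 := by positivity
  have hb : ENNReal.ofReal (B * t / 2) ≤
      tankNorm p (ωθ t) * ENNReal.ofReal ((C / t ^ 2) ^ (1 - s)) := by
    refine (ENNReal.ofReal_le_ofReal hSi).trans (hH.trans ?_)
    rw [← ENNReal.ofReal_rpow_of_pos hX]
    gcongr
  have hXp : 0 < (C / t ^ 2) ^ (1 - s) := Real.rpow_pos_of_pos hX _
  refine (ENNReal.mul_le_mul_iff_left (c := ENNReal.ofReal ((C / t ^ 2) ^ (1 - s)))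
    (ENNReal.ofReal_pos.2 hXp).ne' ENNReal.ofReal_ne_top).1 (le_trans ?_ hb)
  rw [← ENNReal.ofReal_mul (by positivity)]
  refine ENNReal.ofReal_le_ofReal ?_
  -- The `+ 1` in `C` ensures `C ≥ 1`, which makes the final constant independent of `p`.
  have hCp : C ^ (1 - s) ≤ C := by
    calc C ^ (1 - s) ≤ C ^ (1 : ℝ) := Real.rpow_le_rpow_of_exponent_le hC1 (by linarith)
      _ = C := Real.rpow_one C
  have htp : t ^ (3 - 2 * s) = t * (t ^ 2) ^ (1 - s) := by
    rw [← Real.rpow_natCast t 2, ← Real.rpow_mul ht0.le]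
    nth_rewrite 2 [← Real.rpow_one t]
    rw [← Real.rpow_add ht0]
    congr 1
    push_cast
    ring
  have ht2 : 0 < (t ^ 2) ^ (1 - s) := by positivity
  rw [Real.div_rpow hC0.le (by positivity), htp]
  calc B / (2 * C) * (t * (t ^ 2) ^ (1 - s)) * (C ^ (1 - s) / (t ^ 2) ^ (1 - s))
      = B / (2 * C) * t * C ^ (1 - s) := by field_simp
    _ ≤ B / (2 * C) * t * C := by gcongr
    _ = B * t / 2 := by field_simp

end IsSmoothSolution

end

end AxiEuler

/-! ### Choice of the constants and conclusion. -/

theorem theorem1p4 (uθ₀ ωθ₀ : ℝ → ℝ → ℝ)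
    (huθ₀ : AxiEuler.SmoothProfile uθ₀) (hωθ₀ : AxiEuler.SmoothProfile ωθ₀)
    (heven : ∀ r ∈ AxiEuler.radii, ∀ z, uθ₀ r (-z) = uθ₀ r z)
    (hodd : ∀ r ∈ AxiEuler.radii, ∀ z, ωθ₀ r (-z) = -ωθ₀ r z)
    (k₀ : ℝ) (hk₀ : 0 < k₀)
    (hpi : ∀ r ∈ AxiEuler.radii, k₀ ≤ uθ₀ r Real.pi)
    (hzero : ∀ r ∈ AxiEuler.radii, |uθ₀ r 0| ≤ (1 / 8) * k₀) :
    ∃ T₀ c : ℝ, 0 ≤ T₀ ∧ 0 < c ∧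
      (0 ≤ (∫ z in (0 : ℝ)..Real.pi, ∫ r in Real.pi..(2 * Real.pi), ωθ₀ r z) → T₀ = 0) ∧
      ∀ T : EReal, 0 < T → ∀ uθ ωθ ψ : ℝ → ℝ → ℝ → ℝ,
        AxiEuler.IsSmoothSolution T uθ₀ ωθ₀ uθ ωθ ψ →
        ∀ t : ℝ, T₀ ≤ t → (t : EReal) < T →
          (∀ p : ENNReal, 1 ≤ p →
            ENNReal.ofReal (c * t ^ (3 - 2 * (p⁻¹).toReal)) ≤ AxiEuler.tankNorm p (ωθ t)) ∧
          ENNReal.ofReal (c * t) ≤ AxiEuler.tankNorm ⊤ (AxiEuler.velocity uθ ψ t) := by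
  have pp := Real.pi_pos
  set A := ∫ z in (0 : ℝ)..Real.pi, ∫ r in Real.pi..(2 * Real.pi), ωθ₀ r z
  set β := AxiEuler.growthRate k₀ with hβ
  have hβ0 : 0 < β := by rw [hβ, AxiEuler.growthRate]; positivity
  have hE := AxiEuler.IsSmoothSolution.energyBound_nonneg uθ₀ ωθ₀
  -- Half of the growth rate is kept; the other half compensates a negative initial integral `A` as
  -- soon as `t ≥ -A/B`.
  set B := β / 2 with hB
  have hB0 : 0 < B := by positivity
  obtain ⟨C, hC⟩ : ∃ C, C = 64 * (16 * (64 * Real.pi *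
    (AxiEuler.IsSmoothSolution.energyBound uθ₀ ωθ₀ + 1) / B ^ 2)) + 1 := ⟨_, rfl⟩
  have hC0 : 0 < C := by rw [hC]; positivity
  refine ⟨max 0 (-A / B), min (B / (2 * C)) (B / (4 * Real.pi)), le_max_left _ _,
    lt_min (by positivity) (by positivity), fun hA => max_eq_left ?_, ?_⟩
  · exact div_nonpos_of_nonpos_of_nonneg (by linarith) hB0.le
  intro T _ uθ ωθ ψ h t ht htT
  have ht0 : 0 ≤ t := (le_max_left _ _).trans ht
  have hm : B * t ≤ ∫ x in AxiEuler.halfCell, ωθ t x.1 x.2 := by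
    have h1 := h.integral_vorticity_ge heven hodd hk₀ hpi hzero ⟨ht0, htT⟩
    have h2 := (div_le_iff₀ hB0).1 ((le_max_right _ _).trans ht)
    have h3 : β * t = B * t + t * B := by rw [hB]; ring
    linarith
  constructor
  · intro p hp
    rcases ht0.eq_or_lt with rfl | htpos
    · have hs : (p⁻¹).toReal ≤ (1 : ENNReal).toReal :=
        ENNReal.toReal_mono ENNReal.one_ne_top (ENNReal.inv_le_one.2 hp)
      rw [ENNReal.toReal_one] at hs
      -- At `t = 0` the bound is trivial because the exponent `3 - 2/p` is at least `1`, even for `p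
      -- = 1`.
      rw [Real.zero_rpow (by linarith)]
      simp
    · refine le_trans (ENNReal.ofReal_le_ofReal ?_)
        (h.vorticity_lower_bound ⟨ht0, htT⟩ htpos hB0 hm hC hp)
      gcongr
      exact min_le_left _ _
  · refine le_trans (ENNReal.ofReal_le_ofReal ?_) (h.velocity_lower_bound ⟨ht0, htT⟩ hm)
    rw [mul_div_right_comm]
    gcongr
    exact min_le_right _ _
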